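/- Let $(\mathcal H,[\cdot,\cdot])$ be a complex Krein space, i.e. $[\cdot,\cdot]$ is a Hermitian sesquilinear form on $\mathcal H$ and there is a fundamental decomposition $\mathcal H=\mathcal H_+[\dotplus]\mathcal H_-$ into $[\cdot,\cdot]$-orthogonal subspaces such that $(\mathcal H_+,[\cdot,\cdot])$ and $(\mathcal H_-,-[\cdot,\cdot])$ are Hilbert spaces; its signature operator is $J=P_+-P_-$, and $\langle x,y\rangle=[Jx,y]$ is the associated Hilbert space inner product. For Krein spaces $\mathcal H_1,\mathcal H_2$, $L(\mathcal H_1,\mathcal H_2)$ denotes the linear operators that are bounded with respect to associated Hilbert space norms (this does not depend on the decompositions), $T^{\#}$ is the adjoint with respect to the indefinite metrics, $L(\mathcal H)^{[s]}=\{T\in L(\mathcal H):T=T^{\#}\}$, and $T\ge 0$ means that $T\in L(\mathcal H)^{[s]}$ and $[Tx,x]\ge 0$ for all $x$; $S\le T$ means $T-S\ge 0$. For $W\in L(\mathcal H)^{[s]}$ let $\nu_-[W]\in\{0,1,\dots,\infty\}$ be the number of negative squares of $[Wf,f]$, i.e. the supremum of the dimensions of finite-dimensional subspaces on which this quadratic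 form is negative definite. Let $\mathcal S$ be a regular subspace of $\mathcal H$, i.e. $\mathcal H=\mathcal S\,[\dotplus]\,\mathcal S^{[\perp]}$, where $\mathcal S^{[\perp]}$ is the orthogonal companion of $\mathcal S$; then $\mathcal S$ and $\mathcal S^{[\perp]}$ are Krein spaces in the metric of $\mathcal H$. Let $$W^0=\begin{pmatrix} w_{11}&w_{12}\\ w_{12}^{\#}&*\end{pmatrix}$$ be a bounded incomplete block operator with respect to $\mathcal S\,[\dotplus]\,\mathcal S^{[\perp]}$, where $w_{11}\in L(\mathcal S)^{[s]}$ and $w_{12}\in L(\mathcal S^{[\perp]},\mathcal S)$, and assume that $\nu_-[w_{11}]<\infty$. Let $w_{11}=dd^{\#}$ be any polar factorization of $w_{11}$, that is: for some signature operator $J_1$ of $\mathcal S$, with the polar decomposition $J_1w_{11}=u\,|J_1w_{11}|$ in the associated Hilbert space ($u$ the partial isometry with $N(u)=N(J_1w_{11})$), $\mathcal K=\overline{R(|J_1w_{11}|)}$ is the Krein space with the metric $[k,k']_{\mathcal K}=\langle uk,k'\rangle$, and $d:\mathcal K\to\mathcal S$ is $dk=J_1|J_1w_{11}|^{1/2}k$.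 Put $$\mathcal W=\Big\{w_{22}\in L(\mathcal S^{[\perp]})^{[s]}:\ \nu_-\begin{bmatrix} w_{11}&w_{12}\\ w_{12}^{\#}&w_{22}\end{bmatrix}=\nu_-[w_{11}]\Big\}.$$ Then $\mathcal W\neq\emptyset$ (i.e. there is a selfadjoint completion $W$ of $W^0$ with $\nu_-[W]=\nu_-[w_{11}]$) if and only if $R(w_{12})\subseteq R(d)$. In this case the equation $w_{12}=dx$ has a unique solution $y\in L(\mathcal S^{[\perp]},\mathcal K)$, the operator $y^{\#}y$ is the minimum of $\mathcal W$ (it belongs to $\mathcal W$ and $y^{\#}y\le w_{22}$ for every $w_{22}\in\mathcal W$), and $$\mathcal W=\{w_{22}\in L(\mathcal S^{[\perp]})^{[s]}:\ w_{22}=y^{\#}y+z\ \text{ for some } z\in L(\mathcal S^{[\perp]}),\ z=z^{\#}\ge 0\}.$$ -/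

import Mathlib

open scoped ComplexConjugate

noncomputable section

namespace Krein

universe u v

/-- Sesquilinear forms on a complex vector space. As everywhere in Mathlib they are conjugate-linear
in the first and linear in the second argument. -/
abbrev Form (H : Type u) [AddCommGroup H] [Module ℂ H] : Type u := H →ₗ⋆[ℂ] H →ₗ[ℂ] ℂ

/-- The restriction of a form to a subspace. -/
abbrev Form.restrict {H : Type u} [AddCommGroup H] [Module ℂ H] (B : Form H)
    (S : Submodule ℂ H) : Form S :=
  B.domRestrict₁₂ S S

/-- `(P, B)` is a Hilbert space: `B` is an inner product on `P` and `P` is complete for the norm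
`x ↦ B(x, x)^{1/2}`. -/
def IsHilbert {P : Type u} [AddCommGroup P] [Module ℂ P] (B : Form P) : Prop :=
  ∃ c : InnerProductSpace.Core ℂ P, (∀ x y, c.inner x y = B x y) ∧
    @CompleteSpace P c.toNormedAddCommGroup.toMetricSpace.toUniformSpace

/-- A fundamental decomposition `H = H₊ [∔] H₋`: the two subspaces are `B`-orthogonal and
complementary, and `(H₊, B)` and `(H₋, -B)` are Hilbert spaces. -/
structure FundDecomp {H : Type u} [AddCommGroup H] [Module ℂ H] (B : Form H) where
  pos : Submodule ℂ H
  neg : Submodule ℂ H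
  isCompl : IsCompl pos neg
  orth : ∀ x ∈ pos, ∀ y ∈ neg, B x y = 0
  hilbert_pos : IsHilbert (Form.restrict B pos)
  hilbert_neg : IsHilbert (-Form.restrict B neg)

/-- `(H, B)` is a Krein space: `B` is Hermitian and there is a fundamental decomposition. -/
structure IsKreinSpace {H : Type u} [AddCommGroup H] [Module ℂ H] (B : Form H) : Prop where
  symm : B.IsSymm
  exists_decomp : Nonempty (FundDecomp B)

namespace FundDecomp

variable {H : Type u} [AddCommGroup H] [Module ℂ H] {B : Form H}

/-- The projection onto `H₊` along `H₋`. -/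
def projPos (D : FundDecomp B) : H →ₗ[ℂ] D.pos := D.pos.projectionOnto D.neg D.isCompl

/-- The projection onto `H₋` along `H₊`. -/
def projNeg (D : FundDecomp B) : H →ₗ[ℂ] D.neg := D.neg.projectionOnto D.pos D.isCompl.symm

/-- The signature operator `J = P₊ - P₋` of a fundamental decomposition. -/
def signature (D : FundDecomp B) : H →ₗ[ℂ] H :=
  D.pos.subtype ∘ₗ D.projPos - D.neg.subtype ∘ₗ D.projNeg

theorem projPos_add_projNeg (D : FundDecomp B) (x : H) :
    (D.projPos x : H) + (D.projNeg x : H) = x :=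
  Submodule.projection_add_projection_eq_self D.isCompl x

/-- The inner product `⟨x, y⟩ = B(x₊, y₊) - B(x₋, y₋)` of the Hilbert space direct sum of `(H₊, B)`
and `(H₋, -B)`. -/
@[reducible]
def core (D : FundDecomp B) : InnerProductSpace.Core ℂ H where
  inner x y := B (D.projPos x) (D.projPos y) - B (D.projNeg x) (D.projNeg y)
  conj_inner_symm x y := by
    obtain ⟨c, hc, -⟩ := D.hilbert_pos
    obtain ⟨c', hc', -⟩ := D.hilbert_neg
    have h := c.conj_inner_symm (D.projPos x) (D.projPos y)
    have h' := c'.conj_inner_symm (D.projNeg x) (D.projNeg y)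
    simp only [hc, hc', LinearMap.neg_apply, LinearMap.domRestrict₁₂_apply, map_neg] at h h'
    rw [map_sub, h, neg_injective h']
  re_inner_nonneg x := by
    obtain ⟨c, hc, -⟩ := D.hilbert_pos
    obtain ⟨c', hc', -⟩ := D.hilbert_neg
    have h := c.re_inner_nonneg (D.projPos x)
    have h' := c'.re_inner_nonneg (D.projNeg x)
    simp only [hc, hc', LinearMap.neg_apply, LinearMap.domRestrict₁₂_apply, map_neg] at h h'
    rw [map_sub]
    linarith
  add_left x y z := by simp only [map_add, Submodule.coe_add, LinearMap.add_apply]; ring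
  smul_left x y r := by
    simp only [map_smul, Submodule.coe_smul, LinearMap.map_smulₛₗ, LinearMap.smul_apply,
      smul_eq_mul]
    ring
  definite x hx := by
    obtain ⟨c, hc, -⟩ := D.hilbert_pos
    obtain ⟨c', hc', -⟩ := D.hilbert_neg
    have h := c.re_inner_nonneg (D.projPos x)
    have h' := c'.re_inner_nonneg (D.projNeg x)
    have i := c.conj_inner_symm (D.projPos x) (D.projPos x)
    have i' := c'.conj_inner_symm (D.projNeg x) (D.projNeg x)
    have e := c.definite (D.projPos x)
    have e' := c'.definite (D.projNeg x)
    simp only [hc, hc', LinearMap.neg_apply, LinearMap.domRestrict₁₂_apply, map_neg] at h h' i i' e e'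
    have hx' := congrArg Complex.re hx
    simp only [Complex.sub_re, Complex.zero_re] at hx'
    simp only [RCLike.re_eq_complex_re] at h h'
    have z : B (D.projPos x) (D.projPos x) = 0 := by
      apply Complex.ext
      · simp only [Complex.zero_re]; linarith
      · exact Complex.conj_eq_iff_im.1 i
    have z' : B (D.projNeg x) (D.projNeg x) = 0 := by
      apply Complex.ext
      · simp only [Complex.zero_re]; linarith
      · exact Complex.conj_eq_iff_im.1 (neg_injective i')
    have p := e z
    have p' := e' (by rw [z', neg_zero])
    rw [← D.projPos_add_projNeg x, p, p']
    simp

/-- The Hilbert space associated with a fundamental decomposition: the vector space `H` with the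
inner product `core`. -/
def Hilbert (_D : FundDecomp B) : Type u := H


instance (D : FundDecomp B) : NormedAddCommGroup D.Hilbert :=
  @InnerProductSpace.Core.toNormedAddCommGroup ℂ H _ _ _ D.core

instance (D : FundDecomp B) : InnerProductSpace ℂ D.Hilbert :=
  @InnerProductSpace.ofCore ℂ H _ _ _ D.core.toCore

/-- The identity map from `H` to its associated Hilbert space. -/
def toHilbert (D : FundDecomp B) : H ≃ₗ[ℂ] D.Hilbert := LinearEquiv.refl ℂ H

theorem inner_toHilbert (D : FundDecomp B) (x y : H) :
    InnerProductSpace.toInner.inner (𝕜 := ℂ) (D.toHilbert x) (D.toHilbert y) =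
      B (D.projPos x) (D.projPos y) - B (D.projNeg x) (D.projNeg y) := rfl

instance (D : FundDecomp B) : CompleteSpace D.Hilbert := by
  obtain ⟨c, hc, hC⟩ := D.hilbert_pos
  obtain ⟨c', hc', hC'⟩ := D.hilbert_neg
  let _ : NormedAddCommGroup D.pos := c.toNormedAddCommGroup
  let _ : InnerProductSpace ℂ D.pos := InnerProductSpace.ofCore c.toCore
  let _ : NormedAddCommGroup D.neg := c'.toNormedAddCommGroup
  let _ : InnerProductSpace ℂ D.neg := InnerProductSpace.ofCore c'.toCore
  have _ : CompleteSpace D.pos := hC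
  have _ : CompleteSpace D.neg := hC'
  have key : ∀ x : H, ‖D.toHilbert x‖ ^ 2 = ‖D.projPos x‖ ^ 2 + ‖D.projNeg x‖ ^ 2 := by
    intro x
    have h1 : ‖D.projPos x‖ ^ 2 = (c.inner (D.projPos x) (D.projPos x)).re :=
      norm_sq_eq_re_inner (𝕜 := ℂ) (D.projPos x)
    have h2 : ‖D.projNeg x‖ ^ 2 = (c'.inner (D.projNeg x) (D.projNeg x)).re :=
      norm_sq_eq_re_inner (𝕜 := ℂ) (D.projNeg x)
    rw [h1, h2, hc, hc', norm_sq_eq_re_inner (𝕜 := ℂ), inner_toHilbert]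
    simp [sub_eq_add_neg, Form.restrict, LinearMap.domRestrict₁₂_apply]
  have hpos : ∀ x : H, ‖D.projPos x‖ ≤ ‖D.toHilbert x‖ := fun x =>
    le_of_sq_le_sq (by have := key x; nlinarith [sq_nonneg ‖D.projNeg x‖]) (norm_nonneg _)
  have hneg : ∀ x : H, ‖D.projNeg x‖ ≤ ‖D.toHilbert x‖ := fun x =>
    le_of_sq_le_sq (by have := key x; nlinarith [sq_nonneg ‖D.projPos x‖]) (norm_nonneg _)
  refine Metric.complete_of_cauchySeq_tendsto fun w hw => ?_
  set v : ℕ → H := fun n => D.toHilbert.symm (w n) with hv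
  have hwv : ∀ n, w n = D.toHilbert (v n) := fun n => rfl
  rw [Metric.cauchySeq_iff] at hw
  have c1 : CauchySeq fun n => D.projPos (v n) := by
    rw [Metric.cauchySeq_iff]
    intro ε hε
    obtain ⟨N, hN⟩ := hw ε hε
    refine ⟨N, fun m hm n hn => ?_⟩
    have := hN m hm n hn
    rw [dist_eq_norm] at this ⊢
    rw [← map_sub]
    exact lt_of_le_of_lt (hpos _) (by rwa [hwv, hwv, ← map_sub] at this)
  have c2 : CauchySeq fun n => D.projNeg (v n) := by
    rw [Metric.cauchySeq_iff]
    intro ε hε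
    obtain ⟨N, hN⟩ := hw ε hε
    refine ⟨N, fun m hm n hn => ?_⟩
    have := hN m hm n hn
    rw [dist_eq_norm] at this ⊢
    rw [← map_sub]
    exact lt_of_le_of_lt (hneg _) (by rwa [hwv, hwv, ← map_sub] at this)
  obtain ⟨p, hp⟩ := cauchySeq_tendsto_of_complete c1
  obtain ⟨q, hq⟩ := cauchySeq_tendsto_of_complete c2
  refine ⟨D.toHilbert ((p : H) + (q : H)), ?_⟩
  have e1 : D.projPos ((p : H) + (q : H)) = p := by simp [projPos]
  have e2 : D.projNeg ((p : H) + (q : H)) = q := by simp [projNeg]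
  rw [tendsto_iff_norm_sub_tendsto_zero] at hp hq ⊢
  have lim : Filter.Tendsto (fun n => √(‖D.projPos (v n) - p‖ ^ 2 + ‖D.projNeg (v n) - q‖ ^ 2))
      Filter.atTop (nhds 0) := by
    simpa using ((hp.pow 2).add (hq.pow 2)).sqrt
  refine lim.congr fun n => ?_
  rw [hwv, ← map_sub, ← Real.sqrt_sq (norm_nonneg (D.toHilbert _)), key, map_sub, map_sub, e1, e2]

end FundDecomp

/-- A linear map between Krein spaces belongs to `L(H₁, H₂)` if it is bounded with respect to
associated Hilbert space norms. -/
def IsBoundedOp {H₁ : Type u} {H₂ : Type v} [AddCommGroup H₁] [Module ℂ H₁] [AddCommGroup H₂]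
    [Module ℂ H₂] (B₁ : Form H₁) (B₂ : Form H₂) (T : H₁ →ₗ[ℂ] H₂) : Prop :=
  ∃ (D₁ : FundDecomp B₁) (D₂ : FundDecomp B₂) (C : ℝ),
    ∀ x, ‖D₂.toHilbert (T x)‖ ≤ C * ‖D₁.toHilbert x‖

/-- `T'` is an adjoint of `T` with respect to the indefinite metrics: `[Tx, y] = [x, T'y]`. -/
def IsAdjoint {H₁ : Type u} {H₂ : Type v} [AddCommGroup H₁] [Module ℂ H₁] [AddCommGroup H₂]
    [Module ℂ H₂] (B₁ : Form H₁) (B₂ : Form H₂) (T : H₁ →ₗ[ℂ] H₂) (T' : H₂ →ₗ[ℂ] H₁) : Prop :=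
  ∀ x y, B₂ (T x) y = B₁ x (T' y)

open Classical in
/-- The adjoint `T^#` of an operator between Krein spaces. It exists and is unique for every bounded
operator; the value `0` is only a default for maps without adjoint. -/
def adjoint {H₁ : Type u} {H₂ : Type v} [AddCommGroup H₁] [Module ℂ H₁] [AddCommGroup H₂]
    [Module ℂ H₂] (B₁ : Form H₁) (B₂ : Form H₂) (T : H₁ →ₗ[ℂ] H₂) : H₂ →ₗ[ℂ] H₁ :=
  if h : ∃ T', IsAdjoint B₁ B₂ T T' then h.choose else 0

/-- `T ∈ L(H)^{[s]}`: bounded and selfadjoint for the indefinite metric. -/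
structure IsSelfadjointOp {H : Type u} [AddCommGroup H] [Module ℂ H] (B : Form H)
    (T : H →ₗ[ℂ] H) : Prop where
  bounded : IsBoundedOp B B T
  selfadjoint : IsAdjoint B B T T

/-- `T ∈ L(H)^{[s]}` is positive: `[Tx, x] ≥ 0` for all `x`. -/
structure IsPositiveOp {H : Type u} [AddCommGroup H] [Module ℂ H] (B : Form H)
    (T : H →ₗ[ℂ] H) : Prop extends IsSelfadjointOp B T where
  nonneg : ∀ x, 0 ≤ (B (T x) x).re

/-- The number of negative squares `ν₋[W]` of the quadratic form `[Wf, f]`: the supremum of the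
dimensions of the (finite-dimensional) subspaces on which it is negative definite. -/
def negSquares {H : Type u} [AddCommGroup H] [Module ℂ H] (B : Form H) (W : H →ₗ[ℂ] H) : ℕ∞ :=
  ⨆ (L : Submodule ℂ H) (_ : FiniteDimensional ℂ L) (_ : ∀ f ∈ L, f ≠ 0 → (B (W f) f).re < 0),
    (Module.finrank ℂ L : ℕ∞)

/-- The orthogonal companion `S^{[⊥]}`. -/
def companion {H : Type u} [AddCommGroup H] [Module ℂ H] (B : Form H) (S : Submodule ℂ H) :
    Submodule ℂ H where
  carrier := {x | ∀ s ∈ S, B s x = 0}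
  add_mem' := by
    intro x y hx hy s hs
    rw [map_add, hx s hs, hy s hs, add_zero]
  zero_mem' := fun s _ => map_zero (B s)
  smul_mem' := by
    intro a x hx s hs
    rw [map_smul, hx s hs, smul_zero]

/-- `S` is a regular subspace: `H = S [∔] S^{[⊥]}`. -/
def IsRegular {H : Type u} [AddCommGroup H] [Module ℂ H] (B : Form H) (S : Submodule ℂ H) : Prop :=
  IsCompl S (companion B S)

/-- The operator on `H = S ∔ N` with the block matrix `(a, b; c, e)`. -/
def block {H : Type u} [AddCommGroup H] [Module ℂ H] {S N : Submodule ℂ H} (h : IsCompl S N)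
    (a : S →ₗ[ℂ] S) (b : N →ₗ[ℂ] S) (c : S →ₗ[ℂ] N) (e : N →ₗ[ℂ] N) : H →ₗ[ℂ] H :=
  S.subtype ∘ₗ (a ∘ₗ S.projectionOnto N h + b ∘ₗ N.projectionOnto S h.symm) +
    N.subtype ∘ₗ (c ∘ₗ S.projectionOnto N h + e ∘ₗ N.projectionOnto S h.symm)

/-- The data of a polar factorization of `W ∈ L(H)^{[s]}`: a fundamental decomposition with signature
operator `J` and, in the associated Hilbert space, the operator `JW` with its polar decomposition
`JW = U |JW|`, where `U` is the partial isometry with `N(U) = N(JW)`. -/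
structure PolarFactorization {H : Type u} [AddCommGroup H] [Module ℂ H] (B : Form H)
    (W : H →ₗ[ℂ] H) where
  D : FundDecomp B
  JW : D.Hilbert →L[ℂ] D.Hilbert
  JW_apply : ∀ x, JW (D.toHilbert x) = D.toHilbert (D.signature (W x))
  U : D.Hilbert →L[ℂ] D.Hilbert
  polar : JW = U ∘L CFC.abs JW
  ker_U : U.ker = JW.ker
  isometry_U : ∀ x ∈ U.kerᗮ, ‖U x‖ = ‖x‖

namespace PolarFactorization

variable {H : Type u} [AddCommGroup H] [Module ℂ H] {B : Form H} {W : H →ₗ[ℂ] H}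

/-- The space `K`, the closure of the range of `|JW|` in the associated Hilbert space. -/
def space (p : PolarFactorization B W) : Submodule ℂ p.D.Hilbert :=
  (CFC.abs p.JW).range.topologicalClosure

/-- The indefinite metric of the Krein space `K`, whose signature operator is the restriction
of `U`: `[k, k'] = ⟨U k, k'⟩`. -/
def form (p : PolarFactorization B W) : Form p.space :=
  ((innerₛₗ ℂ).comp (p.U : p.D.Hilbert →ₗ[ℂ] p.D.Hilbert)).domRestrict₁₂ p.space p.space

/-- The factor `d : K → H`, `d k = J |JW|^{1/2} k`, of the polar factorization `W = d d^#`. -/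
def d (p : PolarFactorization B W) : p.space →ₗ[ℂ] H :=
  p.D.signature ∘ₗ p.D.toHilbert.symm.toLinearMap ∘ₗ
    (CFC.sqrt (CFC.abs p.JW) : p.D.Hilbert →L[ℂ] p.D.Hilbert).toLinearMap ∘ₗ p.space.subtype

end PolarFactorization

/-- The set of all `w₂₂ ∈ L(S^{[⊥]})^{[s]}` for which the completion
`W = (w₁₁, w₁₂; w₁₂^#, w₂₂)` has `ν₋[W] = ν₋[w₁₁]`. -/
def solutionSet {H : Type u} [AddCommGroup H] [Module ℂ H] (B : Form H) {S : Submodule ℂ H}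
    (hS : IsRegular B S) (w₁₁ : S →ₗ[ℂ] S) (w₁₂ : companion B S →ₗ[ℂ] S) :
    Set (companion B S →ₗ[ℂ] companion B S) :=
  {w₂₂ | IsSelfadjointOp (Form.restrict B (companion B S)) w₂₂ ∧
    negSquares B (block hS w₁₁ w₁₂
        (adjoint (Form.restrict B (companion B S)) (Form.restrict B S) w₁₂) w₂₂) =
      negSquares (Form.restrict B S) w₁₁}

end Krein

end

open scoped ComplexConjugate

noncomputable section

namespace Krein

universe u v

open scoped InnerProductSpace

section HilbertSpace

variable {E : Type u} [NormedAddCommGroup E] [InnerProductSpace ℂ E]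

/-- `R` is a symmetric operator commuting with the symmetric partial isometry `U`, both with the same
kernel. For a selfadjoint operator `A = U |A|` this is the relation between `U` and `|A|^{1/2}`. -/
structure IsSignedRoot (U R : E →L[ℂ] E) : Prop where
  symm_sign : ∀ x y, ⟪U x, y⟫_ℂ = ⟪x, U y⟫_ℂ
  sign_cube : ∀ x, U (U (U x)) = U x
  symm_root : ∀ x y, ⟪R x, y⟫_ℂ = ⟪x, R y⟫_ℂ
  comm : ∀ x, U (R x) = R (U x)
  sign_sq_root : ∀ x, U (U (R x)) = R x
  ker_le : ∀ x, R x = 0 → U x = 0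

/-- The projection onto the eigenspace of the symmetric partial isometry `U` for the
eigenvalue `-1`. -/
def negProj (U : E →L[ℂ] E) : E →L[ℂ] E := (2⁻¹ : ℂ) • (U ∘L U - U)

theorem negProj_apply (U : E →L[ℂ] E) (x : E) : negProj U x = (2⁻¹ : ℂ) • (U (U x) - U x) := rfl

theorem negProj_of_sign_eq_neg {U : E →L[ℂ] E} {x : E} (hx : U x = -x) : negProj U x = x := by
  rw [negProj_apply, hx, map_neg, hx]
  module

namespace IsSignedRoot

variable {U R : E →L[ℂ] E}

theorem sign_negProj (h : IsSignedRoot U R) (x : E) : U (negProj U x) = -negProj U x := by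
  simp only [negProj_apply, map_smul, map_sub, h.sign_cube]
  module

theorem symm_negProj (h : IsSignedRoot U R) (x y : E) :
    ⟪negProj U x, y⟫_ℂ = ⟪x, negProj U y⟫_ℂ := by
  simp [negProj_apply, h.symm_sign, mul_comm]

theorem negProj_root (h : IsSignedRoot U R) (x : E) : negProj U (R x) = R (negProj U x) := by
  simp [negProj_apply, h.comm]

theorem negProj_negProj (h : IsSignedRoot U R) (x : E) :
    negProj U (negProj U x) = negProj U x :=
  negProj_of_sign_eq_neg (h.sign_negProj x)

theorem norm_sub_negProj_le (h : IsSignedRoot U R) (x : E) : ‖x - negProj U x‖ ≤ ‖x‖ := by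
  have e : ⟪x - negProj U x, negProj U x⟫_ℂ = 0 := by
    rw [← h.symm_negProj, map_sub, h.negProj_negProj, sub_self, inner_zero_left]
  have := norm_add_sq_eq_norm_sq_add_norm_sq_of_inner_eq_zero _ _ e
  rw [sub_add_cancel] at this
  nlinarith [norm_nonneg x, norm_nonneg (x - negProj U x), norm_nonneg (negProj U x)]

theorem sign_sq_of_negProj_eq_zero {x : E} (hx : negProj U x = 0) :
    U (U x) = U x := by
  rw [negProj_apply, smul_eq_zero] at hx
  exact sub_eq_zero.1 (hx.resolve_left (by norm_num))

theorem inner_sign_of_negProj_eq_zero (h : IsSignedRoot U R) {x : E} (hx : negProj U x = 0) :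
    (⟪U x, x⟫_ℂ).re = ‖U x‖ ^ 2 := by
  rw [← sign_sq_of_negProj_eq_zero hx, h.symm_sign, sign_sq_of_negProj_eq_zero hx]
  exact inner_self_eq_norm_sq (𝕜 := ℂ) (U x)

end IsSignedRoot

/-- Douglas' range criterion for a single vector. -/
theorem mem_range_of_norm_inner_le [CompleteSpace E] {R : E →L[ℂ] E}
    (hR : ∀ x y, ⟪R x, y⟫_ℂ = ⟪x, R y⟫_ℂ) {v : E} {c : ℝ}
    (hv : ∀ s, ‖⟪v, s⟫_ℂ‖ ≤ c * ‖R s‖) : ∃ x, R x = v := by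
  have hk : R.toLinearMap.ker ≤ (innerₛₗ ℂ v).ker := by
    intro s hs
    have : R s = 0 := hs
    have h := hv s
    rw [this, norm_zero, mul_zero] at h
    exact norm_le_zero_iff.1 h
  let φ : R.toLinearMap.range →ₗ[ℂ] ℂ :=
    (R.toLinearMap.ker.liftQ (innerₛₗ ℂ v) hk) ∘ₗ R.toLinearMap.quotKerEquivRange.symm.toLinearMap
  have hφ : ∀ s, φ ⟨R s, s, rfl⟩ = ⟪v, s⟫_ℂ := by
    intro s
    have := R.toLinearMap.quotKerEquivRange_symm_apply_image s ⟨s, rfl⟩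
    change R.toLinearMap.ker.liftQ (innerₛₗ ℂ v) hk (R.toLinearMap.quotKerEquivRange.symm ⟨R s, _⟩) = _
    erw [this]
    simp
  obtain ⟨g, hg, -⟩ := exists_extension_norm_eq R.toLinearMap.range
    (φ.mkContinuous c (by
      rintro ⟨_, s, rfl⟩
      rw [show φ ⟨R.toLinearMap s, s, rfl⟩ = _ from hφ s]
      exact hv s))
  refine ⟨(InnerProductSpace.toDual ℂ E).symm g, ext_inner_right ℂ fun s => ?_⟩
  rw [hR, InnerProductSpace.toDual_symm_apply]
  exact (hg ⟨R s, s, rfl⟩).trans (hφ s)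

/-- If the quadratic functional `a + 2 Re ⟪v, ·⟫ + ‖R ·‖ ^ 2` is nonnegative on the multiples of `s`,
then `⟪v, s⟫` is bounded by a multiple of `‖R s‖`. -/
theorem norm_inner_le_of_quadratic_nonneg {R : E →L[ℂ] E} {v : E} {a : ℝ} {s : E}
    (h : ∀ c : ℂ, 0 ≤ a + 2 * (⟪v, c • s⟫_ℂ).re + ‖R (c • s)‖ ^ 2) :
    ‖⟪v, s⟫_ℂ‖ ≤ √a * ‖R s‖ := by
  have ha : 0 ≤ a := by simpa using h 0
  have key : ∀ t : ℝ, 0 ≤ ‖⟪v, s⟫_ℂ‖ ^ 2 * ‖R s‖ ^ 2 * (t * t) + 2 * ‖⟪v, s⟫_ℂ‖ ^ 2 * t + a := by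
    intro t
    have := h (t * conj ⟪v, s⟫_ℂ)
    rw [inner_smul_right, mul_assoc, mul_comm (conj _), Complex.mul_conj, ← Complex.ofReal_mul,
      Complex.ofReal_re, Complex.normSq_eq_norm_sq, map_smul, norm_smul, norm_mul, RCLike.norm_conj,
      Complex.norm_real, mul_pow, mul_pow, Real.norm_eq_abs, sq_abs] at this
    linarith
  have d := discrim_le_zero key
  rw [discrim] at d
  rcases eq_or_ne ‖⟪v, s⟫_ℂ‖ 0 with z | z
  · rw [z]; positivity
  have zp : 0 < ‖⟪v, s⟫_ℂ‖ ^ 2 := by positivity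
  have : ‖⟪v, s⟫_ℂ‖ ^ 2 ≤ a * ‖R s‖ ^ 2 := by
    by_contra hc
    push Not at hc
    nlinarith [mul_lt_mul_of_pos_left hc zp]
  refine le_of_sq_le_sq ?_ (by positivity)
  rwa [mul_pow, Real.sq_sqrt ha]

section Polar

variable [CompleteSpace E]

theorem abs_apply_eq_zero_iff {A : E →L[ℂ] E} (hA : IsSelfAdjoint A) {x : E} : CFC.abs A x = 0 ↔ A x = 0 := by
  have hM : IsSelfAdjoint (CFC.abs A) := (CFC.abs_nonneg A).isSelfAdjoint
  have e : ∀ x, CFC.abs A (CFC.abs A x) = A (A x) := fun x => by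
    have := CFC.abs_mul_abs A
    rw [hA.star_eq] at this
    exact DFunLike.congr_fun this x
  have k : ∀ {T : E →L[ℂ] E}, IsSelfAdjoint T → ∀ x, T (T x) = 0 → T x = 0 := by
    intro T hT x h
    have := hT.isSymmetric x (T x)
    erw [h, inner_zero_right] at this
    exact inner_self_eq_zero.1 this
  constructor
  · intro h
    exact k hA x (by rw [← e, h, map_zero])
  · intro h
    exact k hM x (by rw [e, h, map_zero])

theorem isSignedRoot_of_polar {A U : E →L[ℂ] E} (hA : IsSelfAdjoint A)
    (polar : A = U ∘L CFC.abs A) (ker_U : U.ker = A.ker) (iso : ∀ x ∈ U.kerᗮ, ‖U x‖ = ‖x‖) :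
    IsSignedRoot U (CFC.sqrt (CFC.abs A)) ∧
      ∀ x, x ∈ (CFC.abs A).range.topologicalClosure ↔ U (U x) = x := by
  set M := CFC.abs A with hMdef
  set R := CFC.sqrt M with hRdef
  have hM0 : 0 ≤ M := CFC.abs_nonneg A
  have hM : IsSelfAdjoint M := hM0.isSelfAdjoint
  have hR : IsSelfAdjoint R := (CFC.sqrt_nonneg M).isSelfAdjoint
  have symA : ∀ x y, ⟪A x, y⟫_ℂ = ⟪x, A y⟫_ℂ := hA.isSymmetric
  have symM : ∀ x y, ⟪M x, y⟫_ℂ = ⟪x, M y⟫_ℂ := hM.isSymmetric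
  have symR : ∀ x y, ⟪R x, y⟫_ℂ = ⟪x, R y⟫_ℂ := hR.isSymmetric
  have UM : ∀ x, U (M x) = A x := fun x => (DFunLike.congr_fun polar x).symm
  have RR : ∀ x, R (R x) = M x := fun x => DFunLike.congr_fun (CFC.sqrt_mul_sqrt_self M hM0) x
  have AM : ∀ x, A (M x) = M (A x) := fun x =>
    (DFunLike.congr_fun (CFC.commute_abs_self A hA.isStarNormal).eq x).symm
  have kM : ∀ x, M x = 0 ↔ A x = 0 := fun x => abs_apply_eq_zero_iff hA
  have kU : ∀ x, U x = 0 ↔ A x = 0 := fun x => by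
    have := SetLike.ext_iff.1 ker_U x
    simpa [LinearMap.mem_ker] using this
  have hker : M.ker = U.ker := by
    ext x
    exact (kM x).trans (kU x).symm
  have hK : M.range.topologicalClosure = U.kerᗮ := by
    have := M.orthogonal_ker
    rw [← ContinuousLinearMap.star_eq_adjoint, hM.star_eq] at this
    rw [← hker]; exact this.symm
  have memK : ∀ x, x ∈ U.kerᗮ ↔ ∀ a, U a = 0 → ⟪a, x⟫_ℂ = 0 := fun x =>
    Submodule.mem_orthogonal _ _
  have AK : ∀ x, A x ∈ U.kerᗮ := fun x => (memK _).2 fun a ha => by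
    rw [← symA, (kU a).1 ha, inner_zero_left]
  have dec : ∀ x, ∃ k ∈ U.kerᗮ, ∃ a, U a = 0 ∧ x = k + a := by
    intro x
    have hc : IsClosed (U.ker : Set E) := U.isClosed_ker
    have : CompleteSpace U.ker := hc.completeSpace_coe
    obtain ⟨a, ha, k, hk, e⟩ := U.ker.exists_add_mem_mem_orthogonal x
    exact ⟨k, hk, a, ha, by rw [e, add_comm]⟩
  have cl : ∀ {p : E → Prop}, IsClosed {x | p x} → (∀ x, p (M x)) → ∀ k ∈ U.kerᗮ, p k := by
    intro p hp hx k hk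
    rw [← hK] at hk
    exact closure_minimal (s := (M.range : Set E)) (t := {x | p x})
      (by rintro _ ⟨x, rfl⟩; exact hx x) hp hk
  have UK : ∀ x, U x ∈ U.kerᗮ := by
    have : ∀ k ∈ U.kerᗮ, U k ∈ U.kerᗮ :=
      cl ((Submodule.isClosed_orthogonal _).preimage U.continuous) fun x => by rw [UM]; exact AK x
    intro x
    obtain ⟨k, hk, a, ha, rfl⟩ := dec x
    rw [map_add, ha, add_zero]
    exact this k hk
  have symU : ∀ x y, ⟪U x, y⟫_ℂ = ⟪x, U y⟫_ℂ := by
    have h : ∀ k ∈ U.kerᗮ, ∀ k' ∈ U.kerᗮ, ⟪U k, k'⟫_ℂ = ⟪k, U k'⟫_ℂ := by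
      refine cl (p := fun k => ∀ k' ∈ U.kerᗮ, ⟪U k, k'⟫_ℂ = ⟪k, U k'⟫_ℂ) ?_ fun x => ?_
      · simp only [Set.ofPred_forall]
        exact isClosed_iInter fun k' => isClosed_iInter fun _ =>
          isClosed_eq (by fun_prop) (by fun_prop)
      · refine cl (isClosed_eq (by fun_prop) (by fun_prop)) fun y => ?_
        rw [UM, UM, symA, AM, ← symM]
    intro x y
    obtain ⟨k, hk, a, ha, rfl⟩ := dec x
    obtain ⟨k', hk', a', ha', rfl⟩ := dec y
    have e1 : ⟪a, U k'⟫_ℂ = 0 := (memK _).1 (UK k') a ha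
    have e2 : ⟪U k, a'⟫_ℂ = 0 := by
      rw [← inner_conj_symm, (memK _).1 (UK k) a' ha', map_zero]
    rw [map_add, map_add, ha, ha', add_zero, add_zero, inner_add_left, inner_add_right, e1, e2,
      h k hk k' hk']
  have innerU : ∀ k ∈ U.kerᗮ, ∀ k' ∈ U.kerᗮ, ⟪U k, U k'⟫_ℂ = ⟪k, k'⟫_ℂ := by
    let L : U.kerᗮ →ₗᵢ[ℂ] E :=
      ⟨U.toLinearMap ∘ₗ U.kerᗮ.subtype, fun x => iso x x.2⟩
    intro k hk k' hk'
    exact L.inner_map_map ⟨k, hk⟩ ⟨k', hk'⟩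
  have cube : ∀ x, U (U (U x)) = U x := by
    intro x
    refine ext_inner_right ℂ fun y => ?_
    obtain ⟨k', hk', a', ha', rfl⟩ := dec y
    have e2 : ⟪U x, a'⟫_ℂ = 0 := by
      rw [← inner_conj_symm, (memK _).1 (UK x) a' ha', map_zero]
    rw [symU, map_add, ha', add_zero, innerU _ (UK x) _ hk', inner_add_right, e2, add_zero]
  have sqK : ∀ x, x ∈ U.kerᗮ ↔ U (U x) = x := by
    intro x
    refine ⟨fun hx => ?_, fun hx => hx ▸ UK _⟩
    have m : U (U x) - x ∈ U.kerᗮ := sub_mem (UK _) hx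
    have z := (memK _).1 m (U (U x) - x) (by rw [map_sub, cube, sub_self])
    exact sub_eq_zero.1 (inner_self_eq_zero.1 z)
  have hUM : Commute M U := by
    ext x
    refine ext_inner_right ℂ fun y => ?_
    change ⟪M (U x), y⟫_ℂ = ⟪U (M x), y⟫_ℂ
    rw [symM, symU, UM, UM, symA]
  have hRU : Commute R U := by
    rw [hRdef, CFC.sqrt]
    exact hUM.cfcₙ_nnreal _
  refine ⟨⟨symU, cube, symR, fun x => (DFunLike.congr_fun hRU.eq x).symm, fun x => ?_,
    fun x hx => ?_⟩, fun x => by rw [hK, sqK]⟩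
  · refine (sqK _).1 ((memK _).2 fun a ha => ?_)
    have : R (R a) = 0 := by rw [RR, kM, ← kU, ha]
    have h0 : R a = 0 := by
      have h := symR a (R a)
      rw [this, inner_zero_right] at h
      exact inner_self_eq_zero.1 h
    rw [← symR, h0, inner_zero_left]
  · rw [kU, ← kM, ← RR, hx, map_zero]

end Polar

end HilbertSpace

theorem completeSpace_of_dist_eq {X : Type u} (m : MetricSpace X) [MetricSpace X] [CompleteSpace X]
    (hd : ∀ x y : X, m.dist x y = dist x y) : @CompleteSpace X m.toUniformSpace := by
  refine @Metric.complete_of_cauchySeq_tendsto X m.toPseudoMetricSpace fun w hw => ?_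
  have hw' : CauchySeq w := by
    rw [@Metric.cauchySeq_iff X ℕ m.toPseudoMetricSpace] at hw
    rw [Metric.cauchySeq_iff]
    simpa only [hd] using hw
  obtain ⟨a, ha⟩ := cauchySeq_tendsto_of_complete hw'
  refine ⟨a, ?_⟩
  rw [Metric.tendsto_atTop] at ha
  rw [@Metric.tendsto_atTop X ℕ m.toPseudoMetricSpace]
  simpa only [hd] using ha

theorem isHilbert_of_inner_eq {X : Type u} [NormedAddCommGroup X] [InnerProductSpace ℂ X]
    [CompleteSpace X] {F : Form X} (h : ∀ x y, ⟪x, y⟫_ℂ = F x y) : IsHilbert F := by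
  refine ⟨InnerProductSpace.toCore, h, completeSpace_of_dist_eq
    (InnerProductSpace.toCore : InnerProductSpace.Core ℂ X).toNormedAddCommGroup.toMetricSpace
    fun x y => ?_⟩
  rw [dist_comm x y, dist_eq_norm y x, sub_eq_neg_add, norm_eq_sqrt_re_inner (𝕜 := ℂ)]
  rfl

namespace FundDecomp

variable {H : Type u} [AddCommGroup H] [Module ℂ H] {B : Form H}

theorem projPos_signature (D : FundDecomp B) (x : H) : D.projPos (D.signature x) = D.projPos x := by
  change D.projPos ((D.projPos x : H) - (D.projNeg x : H)) = _
  rw [map_sub]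
  simp only [projPos, projNeg, Submodule.projectionOnto_apply_left,
    Submodule.projectionOnto_apply_right, sub_zero]

theorem projNeg_signature (D : FundDecomp B) (x : H) : D.projNeg (D.signature x) = -D.projNeg x := by
  change D.projNeg ((D.projPos x : H) - (D.projNeg x : H)) = _
  rw [map_sub]
  simp only [projPos, projNeg, Submodule.projectionOnto_apply_left,
    Submodule.projectionOnto_apply_right, zero_sub]

theorem signature_signature (D : FundDecomp B) (x : H) : D.signature (D.signature x) = x := by
  have e : ∀ x, D.signature x = (D.projPos x : H) - (D.projNeg x : H) := fun _ => rfl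
  rw [e (D.signature x), projPos_signature, projNeg_signature, Submodule.coe_neg, sub_neg_eq_add,
    projPos_add_projNeg]

theorem apply_eq_add (hB : B.IsSymm) (D : FundDecomp B) (x y : H) :
    B x y = B (D.projPos x) (D.projPos y) + B (D.projNeg x) (D.projNeg y) := by
  conv_lhs => rw [← D.projPos_add_projNeg x, ← D.projPos_add_projNeg y]
  have h1 := D.orth _ (D.projPos x).2 _ (D.projNeg y).2
  have h2 : B (D.projNeg x) (D.projPos y) = 0 :=
    hB.eq_iff.1 (D.orth _ (D.projPos y).2 _ (D.projNeg x).2)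
  simp only [map_add, LinearMap.add_apply, h1, h2]
  ring

theorem inner_signature_left (hB : B.IsSymm) (D : FundDecomp B) (x y : H) :
    ⟪D.toHilbert (D.signature x), D.toHilbert y⟫_ℂ = B x y := by
  rw [D.apply_eq_add hB]
  refine (D.inner_toHilbert _ _).trans ?_
  rw [projPos_signature, projNeg_signature]
  simp

theorem inner_signature_right (hB : B.IsSymm) (D : FundDecomp B) (x y : H) :
    ⟪D.toHilbert x, D.toHilbert (D.signature y)⟫_ℂ = B x y := by
  rw [D.apply_eq_add hB]
  refine (D.inner_toHilbert _ _).trans ?_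
  rw [projPos_signature, projNeg_signature]
  simp

theorem eq_zero_of_forall_apply (hB : B.IsSymm) (D : FundDecomp B) {x : H}
    (hx : ∀ y, B x y = 0) : x = 0 := by
  have h := hx (D.signature x)
  rw [← D.inner_signature_right hB, signature_signature] at h
  exact D.toHilbert.map_eq_zero_iff.1 (inner_self_eq_zero.1 h)

end FundDecomp

section Operators

variable {H₁ : Type u} {H₂ : Type v} [AddCommGroup H₁] [Module ℂ H₁] [AddCommGroup H₂]
  [Module ℂ H₂] {B₁ : Form H₁} {B₂ : Form H₂}

/-- An operator is bounded as soon as the functionals `[T ·, g]` are represented by vectors for all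
`g` in a separating set. -/
theorem isBoundedOp_of_separating (h₁ : B₁.IsSymm) (h₂ : B₂.IsSymm) (D₁ : FundDecomp B₁)
    (D₂ : FundDecomp B₂) {T : H₁ →ₗ[ℂ] H₂} {M : Set H₂}
    (hM : ∀ k, (∀ g ∈ M, B₂ k g = 0) → k = 0) (hT : ∀ g ∈ M, ∃ h, ∀ x, B₂ (T x) g = B₁ x h) :
    IsBoundedOp B₁ B₂ T := by
  let L : D₁.Hilbert →ₗ[ℂ] D₂.Hilbert :=
    D₂.toHilbert.toLinearMap ∘ₗ T ∘ₗ D₁.toHilbert.symm.toLinearMap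
  have hL : ∀ x, L (D₁.toHilbert x) = D₂.toHilbert (T x) := fun x => rfl
  have hc : Continuous L := by
    refine L.continuous_of_seq_closed_graph fun w x y hw hLw => ?_
    obtain ⟨x, rfl⟩ := D₁.toHilbert.surjective x
    obtain ⟨y, rfl⟩ := D₂.toHilbert.surjective y
    rw [hL]
    refine congrArg _ (sub_eq_zero.1 (hM _ fun g hg => ?_))
    obtain ⟨h, hh⟩ := hT g hg
    have t1 := hLw.inner (tendsto_const_nhds (x := D₂.toHilbert (D₂.signature g))) (𝕜 := ℂ)
    have t2 := hw.inner (tendsto_const_nhds (x := D₁.toHilbert (D₁.signature h))) (𝕜 := ℂ)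
    have e : ∀ n, ⟪L (w n), D₂.toHilbert (D₂.signature g)⟫_ℂ =
        ⟪w n, D₁.toHilbert (D₁.signature h)⟫_ℂ := by
      intro n
      obtain ⟨z, hz⟩ := D₁.toHilbert.surjective (w n)
      rw [← hz, hL, D₂.inner_signature_right h₂, D₁.inner_signature_right h₁, hh]
    have : B₂ y g = B₂ (T x) g := by
      rw [hh, ← D₂.inner_signature_right h₂, ← D₁.inner_signature_right h₁]
      exact tendsto_nhds_unique t1 (t2.congr fun n => (e n).symm)
    rw [map_sub, LinearMap.sub_apply, this, sub_self]
  exact ⟨D₁, D₂, ‖(⟨L, hc⟩ : D₁.Hilbert →L[ℂ] D₂.Hilbert)‖, fun x =>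
    (⟨L, hc⟩ : D₁.Hilbert →L[ℂ] D₂.Hilbert).le_opNorm (D₁.toHilbert x)⟩

theorem IsBoundedOp.exists_isAdjoint (h₁ : B₁.IsSymm) (h₂ : B₂.IsSymm) {T : H₁ →ₗ[ℂ] H₂}
    (hT : IsBoundedOp B₁ B₂ T) : ∃ T', IsAdjoint B₁ B₂ T T' := by
  obtain ⟨D₁, D₂, C, hC⟩ := hT
  let L : D₁.Hilbert →L[ℂ] D₂.Hilbert :=
    (D₂.toHilbert.toLinearMap ∘ₗ T ∘ₗ D₁.toHilbert.symm.toLinearMap).mkContinuous C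
      fun x => hC (D₁.toHilbert.symm x)
  refine ⟨D₁.signature ∘ₗ D₁.toHilbert.symm.toLinearMap ∘ₗ
    (ContinuousLinearMap.adjoint L).toLinearMap ∘ₗ D₂.toHilbert.toLinearMap ∘ₗ D₂.signature,
    fun x y => ?_⟩
  rw [← D₁.inner_signature_right h₁, ← D₂.inner_signature_right h₂]
  simp only [LinearMap.comp_apply, FundDecomp.signature_signature, LinearEquiv.coe_coe,
    LinearEquiv.apply_symm_apply]
  exact (ContinuousLinearMap.adjoint_inner_right L (D₁.toHilbert x) _).symm

theorem IsBoundedOp.isAdjoint_adjoint (h₁ : B₁.IsSymm) (h₂ : B₂.IsSymm) {T : H₁ →ₗ[ℂ] H₂}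
    (hT : IsBoundedOp B₁ B₂ T) : IsAdjoint B₁ B₂ T (adjoint B₁ B₂ T) := by
  have h := hT.exists_isAdjoint h₁ h₂
  rw [adjoint, dif_pos h]
  exact h.choose_spec

theorem IsAdjoint.symm (h₁ : B₁.IsSymm) (h₂ : B₂.IsSymm) {T : H₁ →ₗ[ℂ] H₂} {T' : H₂ →ₗ[ℂ] H₁}
    (h : IsAdjoint B₁ B₂ T T') : IsAdjoint B₂ B₁ T' T := fun x y => by
  rw [← h₁.eq, ← h, h₂.eq]

/-- An everywhere defined selfadjoint operator is bounded. -/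
theorem IsAdjoint.isSelfadjointOp (h₁ : B₁.IsSymm) (D : FundDecomp B₁) {T : H₁ →ₗ[ℂ] H₁}
    (hT : IsAdjoint B₁ B₁ T T) : IsSelfadjointOp B₁ T :=
  ⟨isBoundedOp_of_separating h₁ h₁ D D (M := Set.univ)
    (fun _ hk => D.eq_zero_of_forall_apply h₁ fun y => hk y trivial) fun g _ => ⟨T g, fun x => hT x g⟩,
    hT⟩

end Operators

section NegSquares

variable {H : Type u} [AddCommGroup H] [Module ℂ H] {B : Form H} {W : H →ₗ[ℂ] H}

theorem finrank_le_negSquares {L : Submodule ℂ H} [hL : FiniteDimensional ℂ L]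
    (h : ∀ f ∈ L, f ≠ 0 → (B (W f) f).re < 0) : (Module.finrank ℂ L : ℕ∞) ≤ negSquares B W :=
  le_iSup_of_le L (le_iSup_of_le hL (le_iSup_of_le h le_rfl))

theorem negSquares_le {m : ℕ∞} (h : ∀ L : Submodule ℂ H, FiniteDimensional ℂ L →
    (∀ f ∈ L, f ≠ 0 → (B (W f) f).re < 0) → (Module.finrank ℂ L : ℕ∞) ≤ m) : negSquares B W ≤ m :=
  iSup_le fun L => iSup_le fun hL => iSup_le fun hf => h L hL hf

/-- A vector orthogonal, in the metric of `W`, to a negative definite subspace of dimension `ν₋[W]`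
is nonnegative. -/
theorem nonneg_of_orthogonal_of_negSquares_le (hB : B.IsSymm) (hW : IsAdjoint B B W W)
    {L : Submodule ℂ H} [FiniteDimensional ℂ L] (hL : ∀ f ∈ L, f ≠ 0 → (B (W f) f).re < 0)
    (hν : negSquares B W ≤ (Module.finrank ℂ L : ℕ∞)) {f : H} (hf : ∀ l ∈ L, B (W f) l = 0) :
    0 ≤ (B (W f) f).re := by
  by_contra! hn
  have hfL : f ∉ L := fun h => by rw [hf f h] at hn; simp at hn
  have hf' : ∀ l ∈ L, B (W l) f = 0 := fun l hl => by rw [hW, ← hB.eq, hf l hl, map_zero]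
  have hneg : ∀ g ∈ L ⊔ Submodule.span ℂ {f}, g ≠ 0 → (B (W g) g).re < 0 := by
    intro g hg h0
    obtain ⟨l, hl, c, rfl⟩ : ∃ l ∈ L, ∃ c : ℂ, l + c • f = g := by
      obtain ⟨l, hl, z, hz, e⟩ := Submodule.mem_sup.1 hg
      obtain ⟨c, rfl⟩ := Submodule.mem_span_singleton.1 hz
      exact ⟨l, hl, c, e⟩
    have e : (B (W (l + c • f)) (l + c • f)).re =
        (B (W l) l).re + Complex.normSq c * (B (W f) f).re := by
      have : B (W (l + c • f)) (l + c • f) = B (W l) l + (Complex.normSq c : ℂ) * B (W f) f := by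
        simp only [map_add, map_smul, LinearMap.map_smulₛₗ, LinearMap.add_apply,
          LinearMap.smul_apply, smul_eq_mul, hf l hl, hf' l hl, Complex.normSq_eq_conj_mul_self]
        ring
      rw [this, Complex.add_re, Complex.re_ofReal_mul]
    rw [e]
    by_cases hc : c = 0
    · subst hc
      rw [zero_smul, add_zero] at h0
      simpa using hL l hl h0
    · have h1 : Complex.normSq c * (B (W f) f).re < 0 :=
        mul_neg_of_pos_of_neg (Complex.normSq_pos.2 hc) hn
      by_cases hl0 : l = 0
      · simpa [hl0] using h1
      · linarith [hL l hl hl0]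
  have h1 := (finrank_le_negSquares hneg).trans hν
  have hlt : L < L ⊔ Submodule.span ℂ {f} :=
    lt_of_le_of_ne le_sup_left fun h => hfL (h ▸ Submodule.mem_sup_right
      (Submodule.mem_span_singleton_self f))
  exact absurd (Submodule.finrank_lt_finrank_of_lt hlt) (not_lt.2 (by exact_mod_cast h1))

end NegSquares

section Blocks

variable {H : Type u} [AddCommGroup H] [Module ℂ H] {B : Form H} {S : Submodule ℂ H}
  {w₁₁ : S →ₗ[ℂ] S} {w₁₂ : companion B S →ₗ[ℂ] S} {w₂₁ : S →ₗ[ℂ] companion B S}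
  {w₂₂ : companion B S →ₗ[ℂ] companion B S}

theorem apply_block (hB : B.IsSymm) (hS : IsCompl S (companion B S))
    (h₁₂ : IsAdjoint (Form.restrict B (companion B S)) (Form.restrict B S) w₁₂ w₂₁)
    (s t : S) (n m : companion B S) :
    B (block hS w₁₁ w₁₂ w₂₁ w₂₂ ((s : H) + n)) ((t : H) + m) =
      B (w₁₁ s) t + B (w₁₂ n) t + conj (B (w₁₂ m) s) + B (w₂₂ n) m := by
  have o : ∀ (a : S) (b : companion B S), B a b = 0 := fun a b => b.2 a a.2
  have o' : ∀ (a : S) (b : companion B S), B b a = 0 := fun a b => hB.eq_iff.1 (o a b)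
  have e : B (w₂₁ s) m = conj (B (w₁₂ m) s) := by
    rw [hB.eq]
    have := h₁₂ m s
    simp only [Form.restrict, LinearMap.domRestrict₁₂_apply] at this
    rw [← hB.eq, ← this, hB.eq]
  have e2 : block hS w₁₁ w₁₂ w₂₁ w₂₂ ((s : H) + n) =
      (w₁₁ s : H) + w₁₂ n + (w₂₁ s + w₂₂ n) := by
    simp [block]
  rw [e2]
  simp only [map_add, LinearMap.add_apply, o, o', e]
  ring

theorem isAdjoint_block (hB : B.IsSymm) (hS : IsCompl S (companion B S))
    (h₁₁ : IsAdjoint (Form.restrict B S) (Form.restrict B S) w₁₁ w₁₁)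
    (h₁₂ : IsAdjoint (Form.restrict B (companion B S)) (Form.restrict B S) w₁₂ w₂₁)
    (h₂₂ : IsAdjoint (Form.restrict B (companion B S)) (Form.restrict B (companion B S)) w₂₂ w₂₂) :
    IsAdjoint B B (block hS w₁₁ w₁₂ w₂₁ w₂₂) (block hS w₁₁ w₁₂ w₂₁ w₂₂) := by
  have dec : ∀ x : H, ∃ (s : S) (n : companion B S), x = (s : H) + n := by
    intro x
    obtain ⟨s, hs, n, hn, h⟩ := Submodule.mem_sup.1 (hS.sup_eq_top ▸ Submodule.mem_top : x ∈ _)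
    exact ⟨⟨s, hs⟩, ⟨n, hn⟩, h.symm⟩
  intro x y
  obtain ⟨s, n, rfl⟩ := dec x
  obtain ⟨t, m, rfl⟩ := dec y
  have e1 : B (w₁₁ t) s = conj (B (w₁₁ s) t) := by rw [hB.eq]; exact h₁₁ t s
  have e2 : B (w₂₂ m) n = conj (B (w₂₂ n) m) := by rw [hB.eq]; exact h₂₂ m n
  rw [← hB.eq _ ((s : H) + n), apply_block hB hS h₁₂, apply_block hB hS h₁₂, e1, e2]
  simp only [map_add, Complex.conj_conj]
  ring

end Blocks

section SignForm

variable {E : Type u} [NormedAddCommGroup E] [InnerProductSpace ℂ E] {U R : E →L[ℂ] E}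
  {K : Submodule ℂ E}

/-- The form `⟪U k, k'⟫` on a subspace `K`. -/
def signForm (U : E →L[ℂ] E) (K : Submodule ℂ E) : Form K :=
  ((innerₛₗ ℂ).comp (U : E →ₗ[ℂ] E)).domRestrict₁₂ K K

theorem signForm_apply (x y : K) : signForm U K x y = ⟪U x, (y : E)⟫_ℂ := rfl

theorem isSymm_signForm (h : IsSignedRoot U R) : (signForm U K).IsSymm :=
  ⟨fun x y => by rw [signForm_apply, signForm_apply, inner_conj_symm, h.symm_sign]⟩

theorem isHilbert_eigenspace [CompleteSpace K] {F : Form K} {ε : ℂ} {N : Submodule ℂ K}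
    (hN : ∀ k : K, k ∈ N ↔ U k = ε • (k : E))
    (hF : ∀ k ∈ N, ∀ k' ∈ N, F k k' = ⟪(k : E), (k' : E)⟫_ℂ) :
    IsHilbert (Form.restrict F N) := by
  have hc : IsClosed (N : Set K) := by
    have : (N : Set K) = {k : K | U k = ε • (k : E)} := Set.ext hN
    rw [this]
    exact isClosed_eq (by fun_prop) (by fun_prop)
  have : CompleteSpace N := hc.completeSpace_coe
  exact isHilbert_of_inner_eq fun (x y : N) => (hF x.1 x.2 y.1 y.2).symm

theorem nonempty_fundDecomp_signForm [CompleteSpace K] (h : IsSignedRoot U R)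
    (hK : ∀ x, x ∈ K ↔ U (U x) = x) : Nonempty (FundDecomp (signForm U K)) := by
  let pos : Submodule ℂ K := LinearMap.ker ((U.toLinearMap - LinearMap.id) ∘ₗ K.subtype)
  let neg : Submodule ℂ K := LinearMap.ker ((U.toLinearMap + LinearMap.id) ∘ₗ K.subtype)
  have hpos : ∀ k : K, k ∈ pos ↔ U k = (k : E) := fun k => by
    simp [pos, sub_eq_zero]
  have hneg : ∀ k : K, k ∈ neg ↔ U k = -(k : E) := fun k => by
    simp [neg, add_eq_zero_iff_eq_neg]
  have hUK : ∀ k : K, U k ∈ K := fun k => (hK _).2 (h.sign_cube k)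
  refine ⟨⟨pos, neg, ⟨?_, ?_⟩, ?_, ?_, ?_⟩⟩
  · rw [Submodule.disjoint_def]
    intro k h1 h2
    rw [hpos] at h1
    rw [hneg, h1, eq_neg_iff_add_eq_zero, ← two_smul ℂ, smul_eq_zero] at h2
    exact Subtype.ext (h2.resolve_left two_ne_zero)
  · rw [codisjoint_iff, eq_top_iff]
    intro k _
    have hk := (hK _).1 k.2
    refine Submodule.mem_sup.2 ⟨(2⁻¹ : ℂ) • (k + ⟨U k, hUK k⟩), ?_,
      (2⁻¹ : ℂ) • (k - ⟨U k, hUK k⟩), ?_, ?_⟩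
    · rw [hpos]
      simp [hk, add_comm]
    · rw [hneg]
      simp [hk, ← smul_neg]
    · module
  · intro x hx y hy
    have e : ⟪(x : E), (y : E)⟫_ℂ = -⟪(x : E), (y : E)⟫_ℂ := by
      conv_lhs => rw [← (hpos x).1 hx, h.symm_sign, (hneg y).1 hy, inner_neg_right]
    rw [signForm_apply, (hpos x).1 hx]
    exact self_eq_neg.1 e
  · refine isHilbert_eigenspace (ε := 1) (U := U) (fun k => by rw [hpos, one_smul]) fun k hk k' _ => ?_
    rw [signForm_apply, (hpos k).1 hk]
  · refine isHilbert_eigenspace (F := -signForm U K) (ε := -1) (U := U)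
      (fun k => by rw [hneg, neg_one_smul]) fun k hk k' _ => ?_
    rw [LinearMap.neg_apply, LinearMap.neg_apply, signForm_apply, (hneg k).1 hk, inner_neg_left,
      neg_neg]

end SignForm

section Model

variable {E : Type u} [NormedAddCommGroup E] [InnerProductSpace ℂ E] {U R : E →L[ℂ] E}

/-- The eigenspace of `U` for the eigenvalue `-1`. -/
def negEigenspace (U : E →L[ℂ] E) : Submodule ℂ E := LinearMap.ker (U.toLinearMap + LinearMap.id)

theorem mem_negEigenspace {x : E} : x ∈ negEigenspace U ↔ U x = -x := by
  simp [negEigenspace, add_eq_zero_iff_eq_neg]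

namespace IsSignedRoot

theorem inner_sign_root (h : IsSignedRoot U R) (x : E) : (⟪U (R x), U (R x)⟫_ℂ) = ⟪R x, R x⟫_ℂ := by
  rw [← h.symm_sign, h.sign_sq_root]

theorem eq_zero_of_root_eq_zero (h : IsSignedRoot U R) {x : E} (hx : U (U x) = x) (h0 : R x = 0) :
    x = 0 := by
  rw [← hx, h.ker_le x h0, map_zero]

theorem root_mem_negEigenspace (h : IsSignedRoot U R) {x : E} (hx : x ∈ negEigenspace U) :
    R x ∈ negEigenspace U := by
  rw [mem_negEigenspace] at hx ⊢
  rw [h.comm, hx, map_neg]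

theorem exists_root_eq (h : IsSignedRoot U R) [FiniteDimensional ℂ (negEigenspace U)] {v : E}
    (hv : v ∈ negEigenspace U) : ∃ m ∈ negEigenspace U, R m = v := by
  let T : negEigenspace U →ₗ[ℂ] negEigenspace U :=
    R.toLinearMap.restrict fun x hx => h.root_mem_negEigenspace hx
  have hinj : Function.Injective T := by
    rw [← LinearMap.ker_eq_bot, LinearMap.ker_eq_bot']
    intro x hx
    refine Subtype.ext (h.eq_zero_of_root_eq_zero ?_ (congrArg Subtype.val hx))
    have := mem_negEigenspace.1 x.2
    rw [this, map_neg, this, neg_neg]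
  obtain ⟨m, hm⟩ := LinearMap.surjective_of_injective hinj ⟨v, hv⟩
  exact ⟨m, m.2, congrArg Subtype.val hm⟩

theorem re_inner_neg (h : IsSignedRoot U R) {x : E} (hx : x ∈ negEigenspace U) (h0 : x ≠ 0) :
    (⟪U (R x), R x⟫_ℂ).re < 0 := by
  rw [mem_negEigenspace.1 (h.root_mem_negEigenspace hx), inner_neg_left, Complex.neg_re, neg_lt_zero]
  refine (inner_self_nonneg (𝕜 := ℂ)).lt_of_ne' fun e => h0 ?_
  refine h.eq_zero_of_root_eq_zero ?_ (inner_self_eq_zero (𝕜 := ℂ).1 ?_)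
  · rw [mem_negEigenspace.1 hx, map_neg, mem_negEigenspace.1 hx, neg_neg]
  · have e' : RCLike.re ⟪R x, R x⟫_ℂ = 0 := e
    rw [← inner_self_ofReal_re, e', RCLike.ofReal_zero]

theorem inner_eq_zero_of_negProj_eq_zero (h : IsSignedRoot U R) {x k : E} (hx : negProj U x = 0)
    (hk : k ∈ negEigenspace U) : ⟪x, k⟫_ℂ = 0 := by
  rw [← negProj_of_sign_eq_neg (mem_negEigenspace.1 hk), ← h.symm_negProj, hx, inner_zero_left]

end IsSignedRoot

variable {V : Type v} [AddCommGroup V] [Module ℂ V] {F : Form V} {W : V →ₗ[ℂ] V}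

/-- A negative definite subspace of a form that dominates `⟪U T ·, T ·⟫` is mapped injectively into
the eigenspace of `U` for the eigenvalue `-1`. -/
theorem exists_le_negEigenspace (h : IsSignedRoot U R) (T : V →ₗ[ℂ] E)
    (hT : ∀ f, (⟪U (T f), T f⟫_ℂ).re ≤ (F (W f) f).re) {L : Submodule ℂ V}
    [FiniteDimensional ℂ L] (hL : ∀ f ∈ L, f ≠ 0 → (F (W f) f).re < 0) :
    ∃ L' ≤ negEigenspace U, FiniteDimensional ℂ L' ∧ Module.finrank ℂ L' = Module.finrank ℂ L := by
  let Q : L →ₗ[ℂ] E := (negProj U).toLinearMap ∘ₗ T ∘ₗ L.subtype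
  have hinj : Function.Injective Q := by
    rw [← LinearMap.ker_eq_bot, LinearMap.ker_eq_bot']
    intro f hf
    by_contra h0
    have h1 := hL f f.2 (fun e => h0 (Subtype.ext e))
    have h2 := h.inner_sign_of_negProj_eq_zero (x := T f) hf
    have h3 := hT f
    rw [h2] at h3
    nlinarith [sq_nonneg ‖U (T f)‖]
  refine ⟨LinearMap.range Q, ?_, inferInstance, LinearMap.finrank_range_of_inj hinj⟩
  rintro _ ⟨f, rfl⟩
  exact mem_negEigenspace.2 (h.sign_negProj _)

section Representation

variable {V₁ : Type v} [AddCommGroup V₁] [Module ℂ V₁] {F₁ : Form V₁} {W₁ : V₁ →ₗ[ℂ] V₁}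
  {e : V₁ ≃ₗ[ℂ] E}

theorem finrank_le_negSquares_of_le_negEigenspace (h : IsSignedRoot U R)
    (hW : ∀ s t, F₁ (W₁ s) t = ⟪U (R (e s)), R (e t)⟫_ℂ) {L : Submodule ℂ E}
    [FiniteDimensional ℂ L] (hL : L ≤ negEigenspace U) :
    (Module.finrank ℂ L : ℕ∞) ≤ negSquares F₁ W₁ := by
  rw [← LinearEquiv.finrank_map_eq e.symm L]
  refine finrank_le_negSquares ?_
  rintro _ ⟨x, hx, rfl⟩ h0
  rw [hW]
  refine h.re_inner_neg (by simpa using hL hx) fun h1 => h0 ?_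
  simpa using h1

theorem negSquares_le_negSquares (h : IsSignedRoot U R)
    (hW : ∀ s t, F₁ (W₁ s) t = ⟪U (R (e s)), R (e t)⟫_ℂ) (T : V →ₗ[ℂ] E)
    (hT : ∀ f, (⟪U (T f), T f⟫_ℂ).re ≤ (F (W f) f).re) : negSquares F W ≤ negSquares F₁ W₁ := by
  refine negSquares_le fun L _ hneg => ?_
  obtain ⟨L', hL', _, hr⟩ := exists_le_negEigenspace h T hT hneg
  rw [← hr]
  exact finrank_le_negSquares_of_le_negEigenspace h hW hL'

theorem finiteDimensional_negEigenspace (h : IsSignedRoot U R)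
    (hW : ∀ s t, F₁ (W₁ s) t = ⟪U (R (e s)), R (e t)⟫_ℂ) (hfin : negSquares F₁ W₁ ≠ ⊤) :
    FiniteDimensional ℂ (negEigenspace U) := by
  obtain ⟨n, hn⟩ := ENat.ne_top_iff_exists.1 hfin
  have : Module.rank ℂ (negEigenspace U) ≤ n := by
    refine rank_le fun s hs => ?_
    have h1 := finrank_le_negSquares_of_le_negEigenspace h hW
      (L := (Submodule.span ℂ (s : Set (negEigenspace U))).map (negEigenspace U).subtype)
      (Submodule.map_subtype_le _ _)
    rw [Submodule.finrank_map_subtype_eq, finrank_span_finset_eq_card hs, ← hn] at h1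
    exact_mod_cast h1
  exact Module.rank_lt_aleph0_iff.1 (this.trans_lt Cardinal.natCast_lt_aleph0)

theorem negSquares_le_finrank_negEigenspace (h : IsSignedRoot U R)
    (hW : ∀ s t, F₁ (W₁ s) t = ⟪U (R (e s)), R (e t)⟫_ℂ) [FiniteDimensional ℂ (negEigenspace U)] :
    negSquares F₁ W₁ ≤ (Module.finrank ℂ (negEigenspace U) : ℕ∞) := by
  refine negSquares_le fun L _ hneg => ?_
  obtain ⟨L', hL', _, hr⟩ := exists_le_negEigenspace h (R.toLinearMap ∘ₗ e.toLinearMap)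
    (fun f => by rw [hW]; exact le_rfl) hneg
  rw [← hr]
  exact_mod_cast Submodule.finrank_mono hL'

end Representation

end Model

section Completion

variable {H : Type u} [AddCommGroup H] [Module ℂ H] {B : Form H} {S : Submodule ℂ H}
  {w₁₁ : S →ₗ[ℂ] S} {w₁₂ : companion B S →ₗ[ℂ] S} {w₂₁ : S →ₗ[ℂ] companion B S}
  {w₂₂ : companion B S →ₗ[ℂ] companion B S}
  {E : Type v} [NormedAddCommGroup E] [InnerProductSpace ℂ E] {U R : E →L[ℂ] E}
  {e : S ≃ₗ[ℂ] E} {c : companion B S → E}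

theorem re_apply_block (hB : B.IsSymm) (hS : IsCompl S (companion B S))
    (h₁₂ : IsAdjoint (Form.restrict B (companion B S)) (Form.restrict B S) w₁₂ w₂₁)
    (s : S) (n : companion B S) :
    (B (block hS w₁₁ w₁₂ w₂₁ w₂₂ ((s : H) + n)) ((s : H) + n)).re =
      (B (w₁₁ s) s).re + 2 * (B (w₁₂ n) s).re + (B (w₂₂ n) n).re := by
  rw [apply_block hB hS h₁₂]
  simp only [Complex.add_re, Complex.conj_re]
  ring

theorem negSquares_le_negSquares_block (hB : B.IsSymm) (hS : IsCompl S (companion B S))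
    (h₁₂ : IsAdjoint (Form.restrict B (companion B S)) (Form.restrict B S) w₁₂ w₂₁) :
    negSquares (Form.restrict B S) w₁₁ ≤ negSquares B (block hS w₁₁ w₁₂ w₂₁ w₂₂) := by
  refine negSquares_le fun L _ hneg => ?_
  rw [← Submodule.finrank_map_subtype_eq S L]
  refine finrank_le_negSquares ?_
  rintro _ ⟨s, hs, rfl⟩ h0
  have := re_apply_block (w₁₁ := w₁₁) (w₂₂ := w₂₂) hB hS h₁₂ s 0
  simp only [map_zero, Submodule.coe_zero, add_zero, LinearMap.zero_apply, Complex.zero_re,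
    mul_zero] at this
  rw [Submodule.subtype_apply, this]
  exact hneg s hs fun h => h0 (by rw [h, map_zero])

/-- If the completion has as many negative squares as `w₁₁`, it is nonnegative on the vectors that
are orthogonal to the negative eigenspace. -/
theorem completion_nonneg (hB : B.IsSymm) (hS : IsCompl S (companion B S))
    (h₁₁ : IsAdjoint (Form.restrict B S) (Form.restrict B S) w₁₁ w₁₁)
    (h₁₂ : IsAdjoint (Form.restrict B (companion B S)) (Form.restrict B S) w₁₂ w₂₁)
    (h₂₂ : IsAdjoint (Form.restrict B (companion B S)) (Form.restrict B (companion B S)) w₂₂ w₂₂)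
    (h : IsSignedRoot U R) [FiniteDimensional ℂ (negEigenspace U)]
    (hW : ∀ s t : S, B (w₁₁ s) t = ⟪U (R (e s)), R (e t)⟫_ℂ)
    (hc : ∀ n (t : S), B (w₁₂ n) t = ⟪c n, e t⟫_ℂ)
    (hν : negSquares B (block hS w₁₁ w₁₂ w₂₁ w₂₂) = negSquares (Form.restrict B S) w₁₁)
    {s : E} {n : companion B S}
    (hs : ∀ k ∈ negEigenspace U, ⟪U (R s), R k⟫_ℂ + ⟪c n, k⟫_ℂ = 0) :
    0 ≤ (⟪U (R s), R s⟫_ℂ).re + 2 * (⟪c n, s⟫_ℂ).re + (B (w₂₂ n) n).re := by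
  obtain ⟨s, rfl⟩ := e.surjective s
  rw [← hW, ← hc, ← re_apply_block hB hS h₁₂]
  let L : Submodule ℂ H := ((negEigenspace U).map (e.symm : E →ₗ[ℂ] S)).map S.subtype
  have hL : ∀ l ∈ L, ∃ t : S, e t ∈ negEigenspace U ∧ l = (t : H) := by
    rintro _ ⟨_, ⟨x, hx, rfl⟩, rfl⟩
    exact ⟨e.symm x, by simpa using hx, rfl⟩
  refine nonneg_of_orthogonal_of_negSquares_le hB (isAdjoint_block hB hS h₁₁ h₁₂ h₂₂) (L := L)
    ?_ ?_ ?_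
  · intro l hl h0
    obtain ⟨t, ht, rfl⟩ := hL l hl
    have := re_apply_block (w₁₁ := w₁₁) (w₂₂ := w₂₂) hB hS h₁₂ t 0
    simp only [map_zero, Submodule.coe_zero, add_zero, LinearMap.zero_apply, Complex.zero_re,
      mul_zero] at this
    rw [this, hW]
    refine h.re_inner_neg ht fun h1 => h0 ?_
    rw [e.map_eq_zero_iff.1 h1, Submodule.coe_zero]
  · rw [hν, Submodule.finrank_map_subtype_eq]
    erw [LinearEquiv.finrank_map_eq e.symm (negEigenspace U)]
    exact negSquares_le_finrank_negEigenspace h (e := e) hW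
  · intro l hl
    obtain ⟨t, ht, rfl⟩ := hL l hl
    have := apply_block (w₁₁ := w₁₁) (w₂₂ := w₂₂) hB hS h₁₂ s t n 0
    simp only [map_zero, Submodule.coe_zero, add_zero, LinearMap.zero_apply] at this
    rw [this, hW, hc, hs _ ht]

/-- Necessity of the range condition. -/
theorem mem_range_root_of_negSquares_eq [CompleteSpace E] (hB : B.IsSymm)
    (hS : IsCompl S (companion B S))
    (h₁₁ : IsAdjoint (Form.restrict B S) (Form.restrict B S) w₁₁ w₁₁)
    (h₁₂ : IsAdjoint (Form.restrict B (companion B S)) (Form.restrict B S) w₁₂ w₂₁)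
    (h₂₂ : IsAdjoint (Form.restrict B (companion B S)) (Form.restrict B (companion B S)) w₂₂ w₂₂)
    (h : IsSignedRoot U R) [FiniteDimensional ℂ (negEigenspace U)]
    (hW : ∀ s t : S, B (w₁₁ s) t = ⟪U (R (e s)), R (e t)⟫_ℂ)
    (hc : ∀ n (t : S), B (w₁₂ n) t = ⟪c n, e t⟫_ℂ)
    (hν : negSquares B (block hS w₁₁ w₁₂ w₂₁ w₂₂) = negSquares (Form.restrict B S) w₁₁)
    (n : companion B S) : ∃ x, R x = c n := by
  obtain ⟨m', hm', e'⟩ := h.exists_root_eq (mem_negEigenspace.2 (h.sign_negProj (c n)))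
  obtain ⟨m, hm, rfl⟩ := h.exists_root_eq hm'
  have hUm : U (R m) = -R m := mem_negEigenspace.1 hm'
  have cross : ∀ s, negProj U s = 0 → ⟪R s, R m⟫_ℂ = 0 := fun s hs => by
    rw [h.symm_root]
    exact h.inner_eq_zero_of_negProj_eq_zero hs (h.root_mem_negEigenspace hm')
  let a : ℝ := (⟪U (R m), R m⟫_ℂ).re + 2 * (⟪c n, m⟫_ℂ).re + (B (w₂₂ n) n).re
  have key : ∀ s, negProj U s = 0 → 0 ≤ a + 2 * (⟪c n, s⟫_ℂ).re + ‖R s‖ ^ 2 := by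
    intro s hs
    have h1 := completion_nonneg hB hS h₁₁ h₁₂ h₂₂ h hW hc hν (s := s + m) (n := n) (by
      intro k hk
      have hUk := mem_negEigenspace.1 (h.root_mem_negEigenspace hk)
      have z : ⟪R s, R k⟫_ℂ = 0 := by
        rw [h.symm_root]
        exact h.inner_eq_zero_of_negProj_eq_zero hs (h.root_mem_negEigenspace (h.root_mem_negEigenspace hk))
      have z' : ⟪R m, R k⟫_ℂ = ⟪c n, k⟫_ℂ := by
        rw [← h.symm_root, e', h.symm_negProj, negProj_of_sign_eq_neg (mem_negEigenspace.1 hk)]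
      rw [h.symm_sign, hUk, map_add, inner_neg_right, inner_add_left, z, z']
      ring)
    have e1 : (⟪U (R s), R s⟫_ℂ).re = ‖R s‖ ^ 2 := by
      have hs' : negProj U (R s) = 0 := by rw [h.negProj_root, hs, map_zero]
      rw [h.inner_sign_of_negProj_eq_zero hs', ← inner_self_eq_norm_sq (𝕜 := ℂ),
        ← inner_self_eq_norm_sq (𝕜 := ℂ), h.inner_sign_root]
    have e2 : ⟪U (R s), R m⟫_ℂ = 0 := by
      rw [h.symm_sign, hUm, inner_neg_right, cross s hs, neg_zero]
    have e3 : ⟪U (R m), R s⟫_ℂ = 0 := by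
      rw [hUm, inner_neg_left, ← inner_conj_symm, cross s hs, map_zero, neg_zero]
    simp only [map_add, inner_add_left, inner_add_right, e2, e3, Complex.add_re, e1,
      Complex.zero_re] at h1
    simp only [a]
    linarith
  obtain ⟨x, hx⟩ : ∃ x, R x = c n - negProj U (c n) := by
    refine mem_range_of_norm_inner_le h.symm_root (c := √a) fun s => ?_
    have hs : negProj U (s - negProj U s) = 0 := by rw [map_sub, h.negProj_negProj, sub_self]
    have e1 : ⟪c n - negProj U (c n), s⟫_ℂ = ⟪c n, s - negProj U s⟫_ℂ := by
      rw [inner_sub_left, inner_sub_right, h.symm_negProj]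
    rw [e1]
    refine (norm_inner_le_of_quadratic_nonneg fun b => key (b • (s - negProj U s)) ?_).trans ?_
    · rw [map_smul, hs, smul_zero]
    · refine mul_le_mul_of_nonneg_left ?_ (Real.sqrt_nonneg a)
      rw [map_sub, ← h.negProj_root]
      exact h.norm_sub_negProj_le _
  exact ⟨x + R m, by rw [map_add, hx, e', sub_add_cancel]⟩

/-- Minimality: the Schur complement `w₂₂ - y^# y` of a completion is nonnegative. -/
theorem schur_nonneg_of_negSquares_eq (hB : B.IsSymm)
    (hS : IsCompl S (companion B S))
    (h₁₁ : IsAdjoint (Form.restrict B S) (Form.restrict B S) w₁₁ w₁₁)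
    (h₁₂ : IsAdjoint (Form.restrict B (companion B S)) (Form.restrict B S) w₁₂ w₂₁)
    (h₂₂ : IsAdjoint (Form.restrict B (companion B S)) (Form.restrict B (companion B S)) w₂₂ w₂₂)
    (h : IsSignedRoot U R) [FiniteDimensional ℂ (negEigenspace U)]
    (hW : ∀ s t : S, B (w₁₁ s) t = ⟪U (R (e s)), R (e t)⟫_ℂ)
    (hc : ∀ n (t : S), B (w₁₂ n) t = ⟪c n, e t⟫_ℂ)
    (hν : negSquares B (block hS w₁₁ w₁₂ w₂₁ w₂₂) = negSquares (Form.restrict B S) w₁₁)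
    (hd : ∀ x, U (U x) = x → x ∈ closure (Set.range R))
    {n : companion B S} {y : E} (hy : U (U y) = y) (hRy : R y = c n) :
    (⟪U y, y⟫_ℂ).re ≤ (B (w₂₂ n) n).re := by
  set v := U y
  have key : ∀ s, negProj U (R s + v) = 0 →
      0 ≤ (⟪U (R s + v), R s + v⟫_ℂ).re + ((B (w₂₂ n) n).re - (⟪v, y⟫_ℂ).re) := by
    intro s hs
    have h1 := completion_nonneg hB hS h₁₁ h₁₂ h₂₂ h hW hc hν (s := s) (n := n) (by
      intro k hk
      have hRk := h.root_mem_negEigenspace hk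
      have z := h.inner_eq_zero_of_negProj_eq_zero hs hRk
      rw [← hRy, h.symm_root, ← hy, ← inner_add_left, ← map_add, h.symm_sign,
        mem_negEigenspace.1 hRk, inner_neg_right, z, neg_zero])
    have e1 : ⟪U (R s), v⟫_ℂ = ⟪R s, y⟫_ℂ := by rw [h.symm_sign, hy]
    have e2 : (⟪R s, y⟫_ℂ).re = (⟪c n, s⟫_ℂ).re := by
      rw [← hRy, h.symm_root y s, ← inner_conj_symm, Complex.conj_re]
    have e3 : ⟪U v, R s⟫_ℂ = ⟪c n, s⟫_ℂ := by rw [hy, ← h.symm_root, hRy]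
    have e4 : ⟪U v, v⟫_ℂ = ⟪v, y⟫_ℂ := by rw [h.symm_sign, hy]
    simp only [map_add, inner_add_left, inner_add_right, e1, e3, e4, Complex.add_re, e2]
    linarith
  by_contra! hlt
  set δ := (⟪v, y⟫_ℂ).re - (B (w₂₂ n) n).re with hδ
  have hδ0 : 0 < δ := sub_pos.2 hlt
  have hq : 0 < δ / (‖U‖ + 1) := by positivity
  obtain ⟨m, hm, em⟩ := h.exists_root_eq (mem_negEigenspace.2 (h.sign_negProj v))
  have hv' : v - negProj U v ∈ closure (Set.range R) := by
    refine hd _ ?_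
    rw [map_sub, map_sub, h.sign_negProj, map_neg, h.sign_negProj, neg_neg, hy]
  obtain ⟨_, ⟨s, rfl⟩, hs⟩ := Metric.mem_closure_iff.1 hv' _ (Real.sqrt_pos.2 hq)
  rw [dist_eq_norm] at hs
  set r := v - negProj U v - R s with hr
  have eT : R (negProj U s - s - m) + v = r - negProj U r := by
    simp only [hr, map_sub, em, h.negProj_negProj, h.negProj_root]
    abel
  have h2 := key (negProj U s - s - m) (by rw [eT, map_sub, h.negProj_negProj, sub_self])
  rw [eT] at h2
  have h3 : ‖r - negProj U r‖ ^ 2 < δ / (‖U‖ + 1) := by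
    have := (h.norm_sub_negProj_le r).trans_lt hs
    rwa [Real.lt_sqrt (norm_nonneg _)] at this
  have h4 : (⟪U (r - negProj U r), r - negProj U r⟫_ℂ).re ≤ ‖U‖ * ‖r - negProj U r‖ ^ 2 := by
    refine ((Complex.re_le_norm _).trans (norm_inner_le_norm _ _)).trans ?_
    rw [sq, ← mul_assoc]
    exact mul_le_mul_of_nonneg_right (U.le_opNorm _) (norm_nonneg _)
  rw [lt_div_iff₀ (by positivity)] at h3
  nlinarith [sq_nonneg ‖r - negProj U r‖, norm_nonneg U]

end Completion

namespace PolarFactorization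

variable {V : Type u} [AddCommGroup V] [Module ℂ V] {F : Form V} {W : V →ₗ[ℂ] V}

/-- The operator `|JW|^{1/2}`. -/
def root (p : PolarFactorization F W) : p.D.Hilbert →L[ℂ] p.D.Hilbert := CFC.sqrt (CFC.abs p.JW)

theorem d_apply (p : PolarFactorization F W) (k : p.space) :
    p.d k = p.D.signature (p.D.toHilbert.symm (p.root k)) := rfl

theorem inner_JW (hF : F.IsSymm) (p : PolarFactorization F W) (s t : V) :
    ⟪p.JW (p.D.toHilbert s), p.D.toHilbert t⟫_ℂ = F (W s) t := by
  rw [p.JW_apply, p.D.inner_signature_left hF]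

theorem isSelfAdjoint_JW (hF : F.IsSymm) (hW : IsAdjoint F F W W) (p : PolarFactorization F W) :
    IsSelfAdjoint p.JW := by
  rw [ContinuousLinearMap.isSelfAdjoint_iff_isSymmetric]
  intro x y
  obtain ⟨s, rfl⟩ := p.D.toHilbert.surjective x
  obtain ⟨t, rfl⟩ := p.D.toHilbert.surjective y
  refine (p.inner_JW hF s t).trans ?_
  rw [hW, ← hF.eq, ← p.inner_JW hF]
  exact inner_conj_symm _ _

theorem isSignedRoot (hF : F.IsSymm) (hW : IsAdjoint F F W W) (p : PolarFactorization F W) :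
    IsSignedRoot p.U p.root :=
  (isSignedRoot_of_polar (p.isSelfAdjoint_JW hF hW) p.polar p.ker_U p.isometry_U).1

theorem mem_space (hF : F.IsSymm) (hW : IsAdjoint F F W W) (p : PolarFactorization F W)
    (x : p.D.Hilbert) : x ∈ p.space ↔ p.U (p.U x) = x :=
  (isSignedRoot_of_polar (p.isSelfAdjoint_JW hF hW) p.polar p.ker_U p.isometry_U).2 x

theorem root_root (p : PolarFactorization F W) (x : p.D.Hilbert) :
    p.root (p.root x) = CFC.abs p.JW x :=
  DFunLike.congr_fun (CFC.sqrt_mul_sqrt_self _ (CFC.abs_nonneg p.JW)) x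

theorem apply_eq_inner_root (hF : F.IsSymm) (hW : IsAdjoint F F W W) (p : PolarFactorization F W)
    (s t : V) :
    F (W s) t = ⟪p.U (p.root (p.D.toHilbert s)), p.root (p.D.toHilbert t)⟫_ℂ := by
  have h := p.isSignedRoot hF hW
  have e : p.JW (p.D.toHilbert s) = p.U (p.root (p.root (p.D.toHilbert s))) := by
    rw [p.root_root]
    exact DFunLike.congr_fun p.polar _
  rw [← p.inner_JW hF, e, h.comm, h.symm_root]

theorem mem_closure_range_root (p : PolarFactorization F W) {x : p.D.Hilbert} (hx : x ∈ p.space) :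
    x ∈ closure (Set.range p.root) := by
  refine closure_mono ?_ hx
  rintro _ ⟨z, rfl⟩
  exact ⟨p.root z, p.root_root z⟩

theorem d_eq_iff (p : PolarFactorization F W) (k : p.space) (s : V) :
    p.d k = s ↔ p.root k = p.D.toHilbert (p.D.signature s) := by
  rw [d_apply, ← LinearEquiv.symm_apply_eq]
  constructor
  · rintro rfl
    rw [p.D.signature_signature]
  · intro h
    rw [h, p.D.signature_signature]

theorem d_injective (hF : F.IsSymm) (hW : IsAdjoint F F W W) (p : PolarFactorization F W) :
    Function.Injective p.d := by
  rw [← LinearMap.ker_eq_bot, LinearMap.ker_eq_bot']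
  intro k hk
  rw [d_eq_iff, map_zero, map_zero] at hk
  exact Subtype.ext ((p.isSignedRoot hF hW).eq_zero_of_root_eq_zero
    ((p.mem_space hF hW _).1 k.2) hk)

theorem mem_range_d (hF : F.IsSymm) (hW : IsAdjoint F F W W) (p : PolarFactorization F W) {s : V}
    {x : p.D.Hilbert} (hx : p.root x = p.D.toHilbert (p.D.signature s)) :
    s ∈ LinearMap.range p.d := by
  have h := p.isSignedRoot hF hW
  refine ⟨⟨p.U (p.U x), (p.mem_space hF hW _).2 (by rw [h.sign_cube])⟩, (p.d_eq_iff _ _).2 ?_⟩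
  rw [← hx, ← h.comm, ← h.comm, h.sign_sq_root]

theorem form_isSymm (hF : F.IsSymm) (hW : IsAdjoint F F W W) (p : PolarFactorization F W) :
    p.form.IsSymm :=
  isSymm_signForm (p.isSignedRoot hF hW)

theorem nonempty_fundDecomp_form (hF : F.IsSymm) (hW : IsAdjoint F F W W)
    (p : PolarFactorization F W) : Nonempty (FundDecomp p.form) := by
  have : CompleteSpace p.space := Submodule.topologicalClosure.completeSpace _
  exact nonempty_fundDecomp_signForm (p.isSignedRoot hF hW) (p.mem_space hF hW)

/-- A solution `y` of `w = d y` is bounded if `w` is. -/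
theorem isBoundedOp_of_d_comp (hF : F.IsSymm) (hW : IsAdjoint F F W W)
    (p : PolarFactorization F W) {N : Type v} [AddCommGroup N] [Module ℂ N] {G : Form N}
    (hG : G.IsSymm) {w : N →ₗ[ℂ] V} (hw : IsBoundedOp G F w) {y : N →ₗ[ℂ] p.space}
    (hy : p.d ∘ₗ y = w) : IsBoundedOp G p.form y := by
  have h := p.isSignedRoot hF hW
  have hUR : ∀ x, p.U (p.root x) ∈ p.space := fun x =>
    (p.mem_space hF hW _).2 (by rw [h.sign_cube])
  have hform : ∀ (k : p.space) x, p.form k ⟨p.U (p.root x), hUR x⟩ = ⟪p.root k, x⟫_ℂ := by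
    intro k x
    change ⟪p.U k, p.U (p.root x)⟫_ℂ = _
    rw [← h.symm_sign, (p.mem_space hF hW _).1 k.2, h.symm_root]
  obtain ⟨w', hw'⟩ := hw.exists_isAdjoint hG hF
  obtain ⟨DK⟩ := p.nonempty_fundDecomp_form hF hW
  obtain ⟨DN, -⟩ := hw
  refine isBoundedOp_of_separating hG (p.form_isSymm hF hW) DN DK
    (M := Set.range fun x => (⟨p.U (p.root x), hUR x⟩ : p.space)) ?_ ?_
  · intro k hk
    have h0 : p.root k = 0 := ext_inner_right ℂ fun x =>
      ((hform k x).symm.trans (hk _ ⟨x, rfl⟩)).trans (inner_zero_left x).symm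
    exact Subtype.ext (h.eq_zero_of_root_eq_zero ((p.mem_space hF hW _).1 k.2) h0)
  · rintro _ ⟨x, rfl⟩
    obtain ⟨t, rfl⟩ := p.D.toHilbert.surjective x
    refine ⟨w' t, fun n => ?_⟩
    rw [hform, ← hw', ← hy, (p.d_eq_iff (y n) _).1 rfl, p.D.inner_signature_left hF]
    rfl

end PolarFactorization

/-- If `w₂₂ - y^# y` is nonnegative, the completion has at most as many negative squares as `w₁₁`. -/
theorem negSquares_block_le {H : Type u} [AddCommGroup H] [Module ℂ H] {B : Form H}
    {S : Submodule ℂ H} {w₁₁ : S →ₗ[ℂ] S} {w₁₂ : companion B S →ₗ[ℂ] S}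
    {w₂₁ : S →ₗ[ℂ] companion B S} {w₂₂ : companion B S →ₗ[ℂ] companion B S}
    {E : Type v} [NormedAddCommGroup E] [InnerProductSpace ℂ E] {U R : E →L[ℂ] E} {e : S ≃ₗ[ℂ] E}
    (hB : B.IsSymm) (hS : IsCompl S (companion B S))
    (h₁₂ : IsAdjoint (Form.restrict B (companion B S)) (Form.restrict B S) w₁₂ w₂₁)
    (h : IsSignedRoot U R) (hW : ∀ s t : S, B (w₁₁ s) t = ⟪U (R (e s)), R (e t)⟫_ℂ)
    (y : companion B S →ₗ[ℂ] E) (hy : ∀ n, U (U (y n)) = y n)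
    (hc : ∀ n (t : S), B (w₁₂ n) t = ⟪R (y n), e t⟫_ℂ)
    (hz : ∀ n : companion B S, (⟪U (y n), y n⟫_ℂ).re ≤ (B (w₂₂ n) n).re) :
    negSquares B (block hS w₁₁ w₁₂ w₂₁ w₂₂) ≤ negSquares (Form.restrict B S) w₁₁ := by
  refine negSquares_le_negSquares h (e := e) hW
    ((R.toLinearMap ∘ₗ e.toLinearMap) ∘ₗ S.projectionOnto (companion B S) hS +
      (U.toLinearMap ∘ₗ y) ∘ₗ (companion B S).projectionOnto S hS.symm) fun f => ?_
  obtain ⟨s, hs, n, hn, rfl⟩ := Submodule.mem_sup.1 (hS.sup_eq_top ▸ Submodule.mem_top : f ∈ _)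
  lift s to S using hs
  lift n to companion B S using hn
  rw [re_apply_block hB hS h₁₂, hW, hc]
  have e0 : ((R.toLinearMap ∘ₗ e.toLinearMap) ∘ₗ S.projectionOnto (companion B S) hS +
      (U.toLinearMap ∘ₗ y) ∘ₗ (companion B S).projectionOnto S hS.symm) ((s : H) + n) =
      R (e s) + U (y n) := by
    simp
  have e1 : ⟪U (R (e s)), U (y n)⟫_ℂ = ⟪R (e s), y n⟫_ℂ := by rw [h.symm_sign, hy]
  have e2 : (⟪R (e s), y n⟫_ℂ).re = (⟪R (y n), e s⟫_ℂ).re := by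
    rw [h.symm_root (y n), ← inner_conj_symm, Complex.conj_re]
  have e3 : ⟪y n, R (e s)⟫_ℂ = ⟪R (y n), e s⟫_ℂ := by rw [← h.symm_root]
  have e4 : (⟪y n, U (y n)⟫_ℂ) = ⟪U (y n), y n⟫_ℂ := by rw [h.symm_sign]
  rw [e0]
  simp only [map_add, inner_add_left, inner_add_right, hy, e1, e3, e4, Complex.add_re, e2]
  linarith [hz n]

end Krein

end

open Krein in
theorem proposition4p13 {H : Type*} [AddCommGroup H] [Module ℂ H] (B : Krein.Form H)
    (hB : Krein.IsKreinSpace B) (S : Submodule ℂ H) (hS : Krein.IsRegular B S)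
    (w₁₁ : S →ₗ[ℂ] S) (hw₁₁ : Krein.IsSelfadjointOp (Krein.Form.restrict B S) w₁₁)
    (w₁₂ : Krein.companion B S →ₗ[ℂ] S)
    (hw₁₂ : Krein.IsBoundedOp (Krein.Form.restrict B (Krein.companion B S))
      (Krein.Form.restrict B S) w₁₂)
    (hfin : Krein.negSquares (Krein.Form.restrict B S) w₁₁ ≠ ⊤)
    (p : Krein.PolarFactorization (Krein.Form.restrict B S) w₁₁) :
    ((Krein.solutionSet B hS w₁₁ w₁₂).Nonempty ↔ LinearMap.range w₁₂ ≤ LinearMap.range p.d) ∧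
    (LinearMap.range w₁₂ ≤ LinearMap.range p.d →
      ∃ y : Krein.companion B S →ₗ[ℂ] p.space,
        (Krein.IsBoundedOp (Krein.Form.restrict B (Krein.companion B S)) p.form y ∧
          p.d ∘ₗ y = w₁₂) ∧
        (∀ y' : Krein.companion B S →ₗ[ℂ] p.space,
          Krein.IsBoundedOp (Krein.Form.restrict B (Krein.companion B S)) p.form y' →
          p.d ∘ₗ y' = w₁₂ → y' = y) ∧
        Krein.adjoint (Krein.Form.restrict B (Krein.companion B S)) p.form y ∘ₗ y ∈
          Krein.solutionSet B hS w₁₁ w₁₂ ∧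
        (∀ w₂₂ ∈ Krein.solutionSet B hS w₁₁ w₁₂,
          Krein.IsPositiveOp (Krein.Form.restrict B (Krein.companion B S))
            (w₂₂ - Krein.adjoint (Krein.Form.restrict B (Krein.companion B S)) p.form y ∘ₗ y)) ∧
        Krein.solutionSet B hS w₁₁ w₁₂ =
          {w₂₂ | Krein.IsSelfadjointOp (Krein.Form.restrict B (Krein.companion B S)) w₂₂ ∧
            ∃ z, Krein.IsPositiveOp (Krein.Form.restrict B (Krein.companion B S)) z ∧
              w₂₂ = Krein.adjoint (Krein.Form.restrict B (Krein.companion B S)) p.form y ∘ₗ y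
                + z}) := by
  have hBs := hB.symm
  have sS : (Form.restrict B S).IsSymm := hBs.domRestrict S
  have sN : (Form.restrict B (companion B S)).IsSymm := hBs.domRestrict _
  have h₁₁ := hw₁₁.selfadjoint
  have h₁₂ := hw₁₂.isAdjoint_adjoint sN sS
  have h := p.isSignedRoot sS h₁₁
  have hW : ∀ s t : S, B (w₁₁ s) t =
      inner ℂ (p.U (p.root (p.D.toHilbert s))) (p.root (p.D.toHilbert t)) :=
    p.apply_eq_inner_root sS h₁₁
  have hc : ∀ (n) (t : S), B (w₁₂ n) t =
      inner ℂ (p.D.toHilbert (p.D.signature (w₁₂ n))) (p.D.toHilbert t) := fun n t =>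
    (p.D.inner_signature_left sS (w₁₂ n) t).symm
  have hfd : FiniteDimensional ℂ (negEigenspace p.U) := finiteDimensional_negEigenspace h hW hfin
  have hN : Nonempty (FundDecomp (Form.restrict B (companion B S))) := ⟨hw₁₂.choose⟩
  obtain ⟨DN⟩ := hN
  have main : LinearMap.range w₁₂ ≤ LinearMap.range p.d → ∃ y : companion B S →ₗ[ℂ] p.space,
      IsBoundedOp (Form.restrict B (companion B S)) p.form y ∧ p.d ∘ₗ y = w₁₂ := by
    intro hr
    let y : companion B S →ₗ[ℂ] p.space :=
      (LinearEquiv.ofInjective p.d (p.d_injective sS h₁₁)).symm.toLinearMap ∘ₗ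
        w₁₂.codRestrict _ fun n => hr ⟨n, rfl⟩
    have hy : p.d ∘ₗ y = w₁₂ := by
      ext n
      have := LinearEquiv.ofInjective_symm_apply (f := p.d) (h := p.d_injective sS h₁₁)
        ⟨w₁₂ n, hr ⟨n, rfl⟩⟩
      exact congrArg _ this
    exact ⟨y, p.isBoundedOp_of_d_comp sS h₁₁ sN hw₁₂ hy, hy⟩
  have sol : ∀ y : companion B S →ₗ[ℂ] p.space,
      IsBoundedOp (Form.restrict B (companion B S)) p.form y → p.d ∘ₗ y = w₁₂ →
      IsSelfadjointOp (Form.restrict B (companion B S))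
        (adjoint (Form.restrict B (companion B S)) p.form y ∘ₗ y) ∧
      (∀ w₂₂ ∈ solutionSet B hS w₁₁ w₁₂, IsPositiveOp (Form.restrict B (companion B S))
        (w₂₂ - adjoint (Form.restrict B (companion B S)) p.form y ∘ₗ y)) ∧
      ∀ z, IsPositiveOp (Form.restrict B (companion B S)) z →
        IsSelfadjointOp (Form.restrict B (companion B S))
          (adjoint (Form.restrict B (companion B S)) p.form y ∘ₗ y + z) →
        adjoint (Form.restrict B (companion B S)) p.form y ∘ₗ y + z ∈
          solutionSet B hS w₁₁ w₁₂ := by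
    intro y hyb hy
    have sK := p.form_isSymm sS h₁₁
    have ha := hyb.isAdjoint_adjoint sN sK
    have ha' := ha.symm sN sK
    have hsq : ∀ n m, Form.restrict B (companion B S)
        ((adjoint (Form.restrict B (companion B S)) p.form y ∘ₗ y) n) m = p.form (y n) (y m) :=
      fun n m => ha' (y n) m
    have hadj : IsAdjoint (Form.restrict B (companion B S)) (Form.restrict B (companion B S))
        (adjoint (Form.restrict B (companion B S)) p.form y ∘ₗ y)
        (adjoint (Form.restrict B (companion B S)) p.form y ∘ₗ y) := fun n m =>
      (hsq n m).trans (ha n (y m))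
    have hyU : ∀ n, p.U (p.U (y n)) = y n := fun n => (p.mem_space sS h₁₁ _).1 (y n).2
    have hRy : ∀ n, p.root (y n) = p.D.toHilbert (p.D.signature (w₁₂ n)) := fun n =>
      (p.d_eq_iff _ _).1 (LinearMap.congr_fun hy n)
    refine ⟨hadj.isSelfadjointOp sN DN, fun w₂₂ hw => ?_, fun z hz hsa => ⟨hsa, ?_⟩⟩
    · have hd : IsAdjoint (Form.restrict B (companion B S)) (Form.restrict B (companion B S))
          (w₂₂ - adjoint (Form.restrict B (companion B S)) p.form y ∘ₗ y)
          (w₂₂ - adjoint (Form.restrict B (companion B S)) p.form y ∘ₗ y) := fun n m => by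
        rw [LinearMap.sub_apply, LinearMap.sub_apply, map_sub, map_sub, LinearMap.sub_apply,
          hw.1.selfadjoint, hadj]
      refine ⟨hd.isSelfadjointOp sN DN, fun n => ?_⟩
      have key := schur_nonneg_of_negSquares_eq hBs hS h₁₁ h₁₂ hw.1.selfadjoint h hW hc hw.2
        (fun x hx => p.mem_closure_range_root ((p.mem_space sS h₁₁ x).2 hx)) (hyU n) (hRy n)
      rw [LinearMap.sub_apply, map_sub, LinearMap.sub_apply, hsq, Complex.sub_re]
      exact sub_nonneg.2 key
    · refine le_antisymm ?_ (negSquares_le_negSquares_block hBs hS h₁₂)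
      refine negSquares_block_le hBs hS h₁₂ h hW (p.space.subtype ∘ₗ y) hyU
        (fun n t => (hc n t).trans (by rw [← hRy]; rfl)) fun n => ?_
      have e1 : Form.restrict B (companion B S)
          ((adjoint (Form.restrict B (companion B S)) p.form y ∘ₗ y + z) n) n =
          p.form (y n) (y n) + Form.restrict B (companion B S) (z n) n := by
        rw [LinearMap.add_apply, map_add, LinearMap.add_apply, hsq]
      have e2 := congrArg Complex.re e1
      rw [Complex.add_re] at e2
      exact (le_add_of_nonneg_right (hz.nonneg n)).trans_eq e2.symm
  have zpos : IsPositiveOp (Form.restrict B (companion B S)) 0 :=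
    ⟨IsAdjoint.isSelfadjointOp sN DN fun n m => by simp, fun n => by simp⟩
  have mem : ∀ y : companion B S →ₗ[ℂ] p.space,
      IsBoundedOp (Form.restrict B (companion B S)) p.form y → p.d ∘ₗ y = w₁₂ →
      adjoint (Form.restrict B (companion B S)) p.form y ∘ₗ y ∈ solutionSet B hS w₁₁ w₁₂ := by
    intro y hyb hy
    obtain ⟨h1, -, h3⟩ := sol y hyb hy
    simpa using h3 0 zpos (by simpa using h1)
  refine ⟨⟨?_, fun hr => ?_⟩, fun hr => ?_⟩
  · rintro ⟨w₂₂, hw⟩ _ ⟨n, rfl⟩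
    obtain ⟨x, hx⟩ := mem_range_root_of_negSquares_eq hBs hS h₁₁ h₁₂ hw.1.selfadjoint h hW hc hw.2 n
    exact p.mem_range_d sS h₁₁ hx
  · obtain ⟨y, hyb, hy⟩ := main hr
    exact ⟨_, mem y hyb hy⟩
  · obtain ⟨y, hyb, hy⟩ := main hr
    obtain ⟨h1, h2, h3⟩ := sol y hyb hy
    refine ⟨y, ⟨hyb, hy⟩, fun y' _ hy' => ?_, mem y hyb hy, h2, Set.ext fun w₂₂ => ⟨fun hw => ?_, ?_⟩⟩
    · ext1 n
      exact p.d_injective sS h₁₁ (LinearMap.congr_fun (hy'.trans hy.symm) n)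
    · exact ⟨hw.1, _, h2 w₂₂ hw, by abel⟩
    · rintro ⟨hsa, z, hz, rfl⟩
      exact h3 z hz hsa
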